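/- For $q\in\mathbb{C}$ with $|q|=1$, let $\mathcal{A}_2^q$ denote the universal unital $C^*$-algebra generated by two isometries $s_1,s_2$ (that is, $s_j^*s_j=1$ for $j=1,2$) satisfying $s_2s_1=q\,s_1s_2$, and let $\mathcal{A}_q$ (the rotation algebra, or non-commutative torus) denote the universal unital $C^*$-algebra generated by two unitaries $u_1,u_2$ satisfying $u_2u_1=q\,u_1u_2$. A normalized tracial state on a unital $C^*$-algebra $A$ is a linear functional $\tau\colon A\to\mathbb{C}$ with $\tau(a^*a)\ge 0$ and $\tau(ab)=\tau(ba)$ for all $a,b\in A$, and $\tau(1)=1$. Let $\theta$ be an irrational real number and let $q=e^{2\pi i\theta}$. Then there exists exactly one normalized tracial state $\widetilde{\tau}$ on $\mathcal{A}_2^q$, and the set $\mathcal{M}=\{a\in\mathcal{A}_2^q : \widetilde{\tau}(a^*a)=0\}$ is the largest proper closed two-sided ideal of $\mathcal{A}_2^q$: it is a proper closed two-sided ideal, and it contains every proper closed two-sided ideal. Moreover, $\mathcal{M}$ is the closed two-sided ideal generated by the projections $1-s_1s_1^*$ and $1-s_2s_2^*$, and the quotient $C^*$-algebra $\mathcal{A}_2^q/\mathcal{M}$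 is isomorphic to $\mathcal{A}_q$ by an isometric $*$-isomorphism that maps the class of $s_j$ to $u_j$ for $j=1,2$. -/

import Mathlib

/-!
Universal C⋆-algebras generated by isometries subject to polynomial relations, the algebra
generated by two isometries with `s₂ s₁ = q s₁ s₂`, the rotation algebra, and tracial states.
-/

noncomputable section

/-! ### Noncommutative ⋆-polynomials -/

/-- The free unital complex algebra on the letters `x` and `x⋆`, for `x : X`
(the letter `(x, false)` stands for `x`, the letter `(x, true)` for `x⋆`). -/
abbrev StarPoly (X : Type) : Type := MonoidAlgebra ℂ (FreeMonoid (X × Bool))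

namespace StarPoly

variable {X : Type}

/-- The letter `x` (for `b = false`) or `x⋆` (for `b = true`). -/
def letter (x : X) (b : Bool) : StarPoly X := MonoidAlgebra.single (FreeMonoid.of (x, b)) 1

/-- The generator `x`. -/
def gen (x : X) : StarPoly X := letter x false

/-- The `ℂ`-linear anti-automorphism that exchanges `x` and `x⋆` and reverses words. -/
def rev : StarPoly X →ₐ[ℂ] (StarPoly X)ᵐᵒᵖ :=
  MonoidAlgebra.lift ℂ (StarPoly X)ᵐᵒᵖ (FreeMonoid (X × Bool))
    (FreeMonoid.lift fun l => MulOpposite.op (letter l.1 (!l.2)))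

/-- Complex conjugation of the coefficients. -/
def conj : StarPoly X →+* StarPoly X := MonoidAlgebra.mapRingHom _ (starRingEnd ℂ)

lemma conj_letter (x : X) (b : Bool) : conj (letter x b) = letter x b := by
  simp [conj, letter]

lemma conj_algebraMap (c : ℂ) :
    conj (algebraMap ℂ (StarPoly X) c) = algebraMap ℂ (StarPoly X) (star c) := by
  simp [conj]

lemma rev_letter (x : X) (b : Bool) :
    rev (letter x b) = MulOpposite.op (letter x (!b)) := by
  simp [rev, letter]

/-- Induction on ⋆-polynomials. -/
lemma poly_induction {P : StarPoly X → Prop} (hc : ∀ c, P (algebraMap ℂ _ c))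
    (hl : ∀ x b, P (letter x b)) (hadd : ∀ f g, P f → P g → P (f + g))
    (hmul : ∀ f g, P f → P g → P (f * g)) (f : StarPoly X) : P f := by
  have key : ∀ w : FreeMonoid (X × Bool), P (MonoidAlgebra.single w 1) := by
    intro w
    induction w using FreeMonoid.inductionOn' with
    | one => simpa using hc 1
    | of_mul l w ih =>
      have := hmul _ _ (hl l.1 l.2) ih
      simpa [letter, MonoidAlgebra.single_mul_single] using this
  induction f using MonoidAlgebra.induction_linear with
  | zero => simpa using hc 0
  | add f g hf hg => exact hadd _ _ hf hg
  | single w c =>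
    have := hmul _ _ (hc c) (key w)
    simpa [MonoidAlgebra.single_mul_single] using this

/-- The involution: conjugate the coefficients, reverse words, exchange `x` and `x⋆`. -/
instance : StarRing (StarPoly X) where
  star f := (rev (conj f)).unop
  star_involutive f := by
    induction f using poly_induction with
    | hc c =>
      beta_reduce
      rw [conj_algebraMap, AlgHom.commutes, MulOpposite.algebraMap_apply, MulOpposite.unop_op,
        conj_algebraMap, AlgHom.commutes, MulOpposite.algebraMap_apply, MulOpposite.unop_op,
        star_star]
    | hl x b => simp [conj_letter, rev_letter]
    | hadd f g hf hg => simp only [map_add, MulOpposite.unop_add, hf, hg]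
    | hmul f g hf hg => simp only [map_mul, MulOpposite.unop_mul, hf, hg]
  star_mul f g := by simp only [map_mul, MulOpposite.unop_mul]
  star_add f g := by simp only [map_add, MulOpposite.unop_add]

lemma star_def (f : StarPoly X) : star f = (rev (conj f)).unop := rfl

lemma star_letter (x : X) (b : Bool) : star (letter x b) = letter x (!b) := by
  simp [star_def, conj_letter, rev_letter]

lemma star_algebraMap (c : ℂ) :
    star (algebraMap ℂ (StarPoly X) c) = algebraMap ℂ (StarPoly X) (star c) := by
  rw [star_def, conj_algebraMap, AlgHom.commutes, MulOpposite.algebraMap_apply,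
    MulOpposite.unop_op]

instance : StarModule ℂ (StarPoly X) where
  star_smul c f := by
    rw [Algebra.smul_def, star_mul, star_algebraMap, ← Algebra.commutes, ← Algebra.smul_def]

/-- Evaluation of ⋆-polynomials at a family of elements of a ⋆-algebra. -/
def eval {B : Type*} [Ring B] [StarRing B] [Algebra ℂ B] (t : X → B) : StarPoly X →ₐ[ℂ] B :=
  MonoidAlgebra.lift ℂ B (FreeMonoid (X × Bool))
    (FreeMonoid.lift fun l => if l.2 then star (t l.1) else t l.1)

lemma eval_letter {B : Type*} [Ring B] [StarRing B] [Algebra ℂ B] (t : X → B) (x : X) (b : Bool) :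
    eval t (letter x b) = if b then star (t x) else t x := by
  simp [eval, letter]

lemma eval_gen {B : Type*} [Ring B] [StarRing B] [Algebra ℂ B] (t : X → B) (x : X) :
    eval t (gen x) = t x := by
  simp [gen, eval_letter]

lemma eval_star {B : Type*} [Ring B] [StarRing B] [Algebra ℂ B] [StarModule ℂ B] (t : X → B)
    (f : StarPoly X) : eval t (star f) = star (eval t f) := by
  induction f using poly_induction with
  | hc c => rw [star_algebraMap, AlgHom.commutes, AlgHom.commutes, algebraMap_star_comm]
  | hl x b => cases b <;> simp [star_letter, eval_letter]
  | hadd f g hf hg => simp [hf, hg]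
  | hmul f g hf hg => simp [hf, hg]

end StarPoly

/-! ### The universal C⋆-algebra generated by isometries subject to relations -/

/-- C⋆-seminorms on ⋆-polynomials. -/
structure IsCStarSeminorm {X : Type} (p : Seminorm ℂ (StarPoly X)) : Prop where
  mul_le : ∀ f g, p (f * g) ≤ p f * p g
  star_mul_self : ∀ f, p (star f * f) = p f * p f

/-- `p` is a C⋆-seminorm for which every generator is an isometry and every element of `R`
vanishes. -/
structure IsAdmissible {X : Type} (R : Set (StarPoly X)) (p : Seminorm ℂ (StarPoly X)) : Prop
    extends IsCStarSeminorm p where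
  isometry : ∀ x, p (star (StarPoly.gen x) * StarPoly.gen x - 1) = 0
  rel : ∀ r ∈ R, p r = 0

/-- The ⋆-algebra of ⋆-polynomials, to be equipped with the largest admissible seminorm. -/
def IsoPre {X : Type} (_R : Set (StarPoly X)) : Type := StarPoly X

namespace IsoPre

variable {X : Type} (R : Set (StarPoly X))

instance : Ring (IsoPre R) := inferInstanceAs (Ring (StarPoly X))
instance : StarRing (IsoPre R) := inferInstanceAs (StarRing (StarPoly X))
instance : Algebra ℂ (IsoPre R) := inferInstanceAs (Algebra ℂ (StarPoly X))
instance : StarModule ℂ (IsoPre R) := inferInstanceAs (StarModule ℂ (StarPoly X))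

/-- The largest admissible seminorm. -/
def maxNorm (f : StarPoly X) : ℝ := ⨆ p : {p : Seminorm ℂ (StarPoly X) // IsAdmissible R p}, p.1 f

instance : Nonempty {p : Seminorm ℂ (StarPoly X) // IsAdmissible R p} :=
  ⟨0, by constructor <;> simp [IsCStarSeminorm.mk]⟩

variable {R}

lemma admissible_one {p : Seminorm ℂ (StarPoly X)} (hp : IsAdmissible R p) : p 1 ≤ 1 := by
  have h := hp.star_mul_self 1
  simp only [star_one, mul_one] at h
  nlinarith [apply_nonneg p 1]

lemma admissible_star {p : Seminorm ℂ (StarPoly X)} (hp : IsAdmissible R p) (f : StarPoly X) :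
    p (star f) = p f := by
  have key : ∀ g, p g ≤ p (star g) := by
    intro g
    have h1 := hp.star_mul_self g
    have h2 := hp.mul_le (star g) g
    by_contra hlt
    nlinarith [apply_nonneg p g, apply_nonneg p (star g)]
  exact le_antisymm (by simpa using key (star f)) (key f)

lemma admissible_gen {p : Seminorm ℂ (StarPoly X)} (hp : IsAdmissible R p) (x : X) :
    p (StarPoly.gen x) ≤ 1 := by
  have h1 := hp.star_mul_self (StarPoly.gen x)
  have h2 := map_add_le_add p (star (StarPoly.gen x) * StarPoly.gen x - 1) 1
  rw [hp.isometry x, sub_add_cancel, h1] at h2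
  nlinarith [admissible_one hp, apply_nonneg p (StarPoly.gen x)]

lemma bounded (f : StarPoly X) : ∃ C, ∀ p, IsAdmissible R p → p f ≤ C := by
  induction f using StarPoly.poly_induction with
  | hc c =>
    refine ⟨‖c‖, fun p hp => ?_⟩
    rw [Algebra.algebraMap_eq_smul_one, map_smul_eq_mul]
    exact mul_le_of_le_one_right (norm_nonneg c) (admissible_one hp)
  | hl x b =>
    refine ⟨1, fun p hp => ?_⟩
    have h : p (StarPoly.letter x false) ≤ 1 := admissible_gen hp x
    cases b with
    | false => exact h
    | true => rwa [← admissible_star hp, StarPoly.star_letter]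
  | hadd f g hf hg =>
    obtain ⟨C, hC⟩ := hf
    obtain ⟨D, hD⟩ := hg
    exact ⟨C + D, fun p hp => (map_add_le_add p f g).trans (add_le_add (hC p hp) (hD p hp))⟩
  | hmul f g hf hg =>
    obtain ⟨C, hC⟩ := hf
    obtain ⟨D, hD⟩ := hg
    exact ⟨C * D, fun p hp => (hp.mul_le f g).trans
      (mul_le_mul (hC p hp) (hD p hp) (apply_nonneg p g) ((apply_nonneg p f).trans (hC p hp)))⟩

lemma le_maxNorm {p : Seminorm ℂ (StarPoly X)} (hp : IsAdmissible R p) (f : StarPoly X) :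
    p f ≤ maxNorm R f := by
  obtain ⟨C, hC⟩ := bounded (R := R) f
  exact le_ciSup (f := fun p : {p : Seminorm ℂ (StarPoly X) // IsAdmissible R p} => p.1 f)
    ⟨C, by rintro _ ⟨p, rfl⟩; exact hC p.1 p.2⟩ ⟨p, hp⟩

lemma maxNorm_le {f : StarPoly X} {C : ℝ} (h : ∀ p, IsAdmissible R p → p f ≤ C) :
    maxNorm R f ≤ C := ciSup_le fun p => h p.1 p.2

lemma maxNorm_nonneg (f : StarPoly X) : 0 ≤ maxNorm R f :=
  Real.iSup_nonneg fun p => apply_nonneg p.1 f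

lemma maxNorm_mul_le (f g : StarPoly X) : maxNorm R (f * g) ≤ maxNorm R f * maxNorm R g :=
  maxNorm_le fun p hp => (hp.mul_le f g).trans
    (mul_le_mul (le_maxNorm hp f) (le_maxNorm hp g) (apply_nonneg p g) (maxNorm_nonneg f))

lemma maxNorm_star (f : StarPoly X) : maxNorm R (star f) = maxNorm R f :=
  congrArg iSup (funext fun p => admissible_star p.2 f)

lemma maxNorm_star_mul_self (f : StarPoly X) :
    maxNorm R f * maxNorm R f ≤ maxNorm R (star f * f) := by
  have h : maxNorm R f ≤ √(maxNorm R (star f * f)) := by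
    refine maxNorm_le fun p hp => Real.le_sqrt_of_sq_le ?_
    rw [pow_two, ← hp.star_mul_self]
    exact le_maxNorm hp _
  calc maxNorm R f * maxNorm R f
      ≤ √(maxNorm R (star f * f)) * √(maxNorm R (star f * f)) :=
        mul_self_le_mul_self (maxNorm_nonneg f) h
    _ = _ := Real.mul_self_sqrt (maxNorm_nonneg _)

lemma maxNorm_smul_le (c : ℂ) (f : StarPoly X) : maxNorm R (c • f) ≤ ‖c‖ * maxNorm R f :=
  maxNorm_le fun p hp => by
    rw [map_smul_eq_mul]
    exact mul_le_mul_of_nonneg_left (le_maxNorm hp f) (norm_nonneg c)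

variable (R) in
/-- `maxNorm` as a ring seminorm. -/
def maxRingSeminorm : RingSeminorm (IsoPre R) where
  toFun := maxNorm R
  map_zero' := le_antisymm (maxNorm_le fun p _ => (map_zero p).le) (maxNorm_nonneg _)
  add_le' f g := maxNorm_le fun p hp =>
    (map_add_le_add p f g).trans (add_le_add (le_maxNorm hp f) (le_maxNorm hp g))
  neg' f := congrArg iSup (funext fun p => map_neg_eq_map p.1 f)
  mul_le' f g := maxNorm_mul_le f g

instance : SeminormedRing (IsoPre R) := (maxRingSeminorm R).toSeminormedRing

lemma norm_def (f : IsoPre R) : ‖f‖ = maxNorm R f := rfl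

instance : NormedAlgebra ℂ (IsoPre R) where
  norm_smul_le c f := maxNorm_smul_le c f

lemma norm_star' (f : IsoPre R) : ‖star f‖ = ‖f‖ := maxNorm_star (R := R) f

lemma uniformContinuous_star : UniformContinuous (star : IsoPre R → IsoPre R) := by
  refine (AddMonoidHomClass.isometry_of_norm (starAddEquiv : IsoPre R ≃+ IsoPre R)
    norm_star').uniformContinuous

end IsoPre

/-- The universal unital C⋆-algebra generated by isometries indexed by `X` that satisfy the
relations `r = 0` for `r ∈ R`: the separated completion of the ⋆-polynomials for the largest
C⋆-seminorm that makes the generators isometries and annihilates `R`. -/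
def IsometryAlgebra {X : Type} (R : Set (StarPoly X)) : Type :=
  UniformSpace.Completion (IsoPre R)

namespace IsometryAlgebra

open UniformSpace

variable {X : Type} {R : Set (StarPoly X)}

instance : NormedRing (IsometryAlgebra R) :=
  inferInstanceAs (NormedRing (Completion (IsoPre R)))

instance : CompleteSpace (IsometryAlgebra R) :=
  inferInstanceAs (CompleteSpace (Completion (IsoPre R)))

instance : NormedAlgebra ℂ (IsometryAlgebra R) where
  toAlgebra := inferInstanceAs (Algebra ℂ (Completion (IsoPre R)))
  norm_smul_le c a := norm_smul_le (β := Completion (IsoPre R)) c a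

variable (R) in
/-- The class of a ⋆-polynomial in the universal C⋆-algebra. -/
def mk : StarPoly X →ₐ[ℂ] IsometryAlgebra R where
  toRingHom := (Completion.coeRingHom : IsoPre R →+* Completion (IsoPre R))
  commutes' _ := rfl

lemma norm_mk (f : StarPoly X) : ‖mk R f‖ = IsoPre.maxNorm R f :=
  Completion.norm_coe (E := IsoPre R) f

lemma denseRange_mk : DenseRange (mk R) :=
  Completion.denseRange_coe (α := IsoPre R)

instance : Star (IsometryAlgebra R) where
  star := Completion.map (star : IsoPre R → IsoPre R)

lemma star_mk (f : StarPoly X) : star (mk R f) = mk R (star f) :=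
  Completion.map_coe (IsoPre.uniformContinuous_star (R := R)) f

lemma continuous_star' : Continuous (star : IsometryAlgebra R → IsometryAlgebra R) :=
  Completion.continuous_map

instance : StarRing (IsometryAlgebra R) where
  star_involutive a := by
    refine denseRange_mk.induction_on (p := fun a => star (star a) = a) a
      (isClosed_eq (continuous_star'.comp continuous_star') continuous_id) fun f => ?_
    rw [star_mk, star_mk, star_star]
  star_mul a b := by
    refine denseRange_mk.induction_on₂ (p := fun a b => star (a * b) = star b * star a)
      (isClosed_eq (continuous_star'.comp (continuous_fst.mul continuous_snd))
        ((continuous_star'.comp continuous_snd).mul (continuous_star'.comp continuous_fst)))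
      (fun f g => ?_) a b
    rw [← map_mul, star_mk, star_mul, map_mul, star_mk, star_mk]
  star_add a b := by
    refine denseRange_mk.induction_on₂ (p := fun a b => star (a + b) = star a + star b)
      (isClosed_eq (continuous_star'.comp (continuous_fst.add continuous_snd))
        ((continuous_star'.comp continuous_fst).add (continuous_star'.comp continuous_snd)))
      (fun f g => ?_) a b
    rw [← map_add, star_mk, star_add, map_add, star_mk, star_mk]

instance : StarModule ℂ (IsometryAlgebra R) where
  star_smul c a := by
    refine denseRange_mk.induction_on (p := fun a => star (c • a) = star c • star a) a
      (isClosed_eq (continuous_star'.comp (continuous_const_smul c))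
        (continuous_star'.const_smul (star c))) fun f => ?_
    rw [← map_smul, star_mk, star_smul, map_smul, star_mk]

instance : CStarRing (IsometryAlgebra R) where
  norm_mul_self_le a := by
    refine denseRange_mk.induction_on (p := fun a => ‖a‖ * ‖a‖ ≤ ‖star a * a‖) a
      (isClosed_le (continuous_norm.mul continuous_norm)
        (continuous_norm.comp (continuous_star'.mul continuous_id))) fun f => ?_
    rw [star_mk, ← map_mul, norm_mk, norm_mk]
    exact IsoPre.maxNorm_star_mul_self f

instance : CStarAlgebra (IsometryAlgebra R) where

variable (R) in
/-- The generating isometries. -/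
def gen (x : X) : IsometryAlgebra R := mk R (StarPoly.gen x)

lemma mk_eq_zero_of_rel {r : StarPoly X} (hr : r ∈ R) : mk R r = 0 := by
  rw [← norm_le_zero_iff, norm_mk]
  exact IsoPre.maxNorm_le fun p hp => (hp.rel r hr).le

lemma star_gen_mul_gen (x : X) : star (gen R x) * gen R x = 1 := by
  have h : mk R (star (StarPoly.gen x) * StarPoly.gen x - 1) = 0 := by
    rw [← norm_le_zero_iff, norm_mk]
    exact IsoPre.maxNorm_le fun p hp => (hp.isometry x).le
  rw [map_sub, map_mul, map_one, sub_eq_zero] at h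
  rw [gen, star_mk, h]

/-- The universal property: isometries in a unital C⋆-algebra `B` that satisfy the relations `R`
are the images of the generators under exactly one unital ⋆-homomorphism. -/
theorem existsUnique_starAlgHom {B : Type*} [CStarAlgebra B] (t : X → B)
    (ht : ∀ x, star (t x) * t x = 1) (hR : ∀ r ∈ R, StarPoly.eval t r = 0) :
    ∃! φ : IsometryAlgebra R →⋆ₐ[ℂ] B, ∀ x, φ (gen R x) = t x := by
  let p : Seminorm ℂ (StarPoly X) :=
    (normSeminorm ℂ B).comp (StarPoly.eval t).toLinearMap
  have hp_apply : ∀ f, p f = ‖StarPoly.eval t f‖ := fun f => rfl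
  have hp : IsAdmissible R p :=
    { mul_le := fun f g => by
        rw [hp_apply, hp_apply, hp_apply, map_mul]; exact norm_mul_le _ _
      star_mul_self := fun f => by
        rw [hp_apply, hp_apply, map_mul, StarPoly.eval_star, CStarRing.norm_star_mul_self]
      isometry := fun x => by
        rw [hp_apply, map_sub, map_mul, StarPoly.eval_star, StarPoly.eval_gen, ht, map_one,
          sub_self, norm_zero]
      rel := fun r hr => by rw [hp_apply, hR r hr, norm_zero] }
  have hle : ∀ f, ‖StarPoly.eval t f‖ ≤ IsoPre.maxNorm R f := fun f => IsoPre.le_maxNorm hp f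
  let ev : IsoPre R →+* B := (StarPoly.eval t).toRingHom
  have hev : Continuous ev :=
    AddMonoidHomClass.continuous_of_bound ev 1 fun f => by
      rw [one_mul]; exact hle f
  let Φ : IsometryAlgebra R →+* B := Completion.extensionHom ev hev
  have hΦc : Continuous Φ := Completion.continuous_extension
  have hΦ : ∀ f, Φ (mk R f) = StarPoly.eval t f := fun f => Completion.extensionHom_coe ev hev f
  refine ⟨{ toFun := Φ, map_one' := map_one Φ, map_mul' := map_mul Φ, map_zero' := map_zero Φ,
            map_add' := map_add Φ, commutes' := fun c => ?_, map_star' := fun a => ?_ },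
    fun x => ?_, fun ψ hψ => ?_⟩
  · have := hΦ (algebraMap ℂ _ c)
    rwa [AlgHom.commutes, AlgHom.commutes] at this
  · refine denseRange_mk.induction_on (p := fun a => Φ (star a) = star (Φ a)) a
      (isClosed_eq (hΦc.comp continuous_star') (hΦc.star)) fun f => ?_
    rw [star_mk, hΦ, hΦ, StarPoly.eval_star]
  · exact (hΦ _).trans (StarPoly.eval_gen t x)
  · have hψc : Continuous ψ := (NonUnitalStarAlgHom.instContinuousLinearMapClassComplex).map_continuous ψ
    have hpoly : ∀ f, ψ (mk R f) = StarPoly.eval t f := by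
      intro f
      induction f using StarPoly.poly_induction with
      | hc c => rw [AlgHom.commutes, AlgHom.commutes]; exact AlgHomClass.commutes ψ c
      | hl x b =>
        have hx : ψ (mk R (StarPoly.letter x false)) = t x := hψ x
        cases b with
        | false => rw [hx]; simp [StarPoly.eval_letter]
        | true =>
          have h : StarPoly.letter x true = star (StarPoly.letter x false) := by
            rw [StarPoly.star_letter]; rfl
          rw [h, ← star_mk, map_star, hx, StarPoly.eval_star]
          simp [StarPoly.eval_letter]
      | hadd f g hf hg => rw [map_add, map_add, map_add, hf, hg]
      | hmul f g hf hg => rw [map_mul, map_mul, map_mul, hf, hg]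
    ext a
    refine denseRange_mk.induction_on (p := fun a => ψ a = Φ a) a (isClosed_eq hψc hΦc) fun f => ?_
    rw [hpoly, hΦ]

end IsometryAlgebra

/-! ### Two `q`-commuting isometries and the rotation algebra -/

/-- The ⋆-polynomial `x₂ x₁ - q x₁ x₂`; the generators `x₁`, `x₂` are indexed by `0`, `1`. -/
def qRel (q : ℂ) : StarPoly (Fin 2) :=
  StarPoly.gen 1 * StarPoly.gen 0 - q • (StarPoly.gen 0 * StarPoly.gen 1)

/-- The C⋆-algebra `𝒜₂^q` generated by isometries `s₁`, `s₂` with `s₂ s₁ = q s₁ s₂`. -/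
abbrev QIsometryAlgebra (q : ℂ) : Type := IsometryAlgebra {qRel q}

/-- The rotation algebra (noncommutative torus) `𝒜_q` generated by unitaries `u₁`, `u₂` with
`u₂ u₁ = q u₁ u₂`; a unitary is an isometry `u` with `u u⋆ = 1`. -/
abbrev RotationAlgebra (q : ℂ) : Type :=
  IsometryAlgebra (insert (qRel q)
    (Set.range fun j : Fin 2 => StarPoly.gen j * star (StarPoly.gen j) - 1))

/-- The generating isometries of `𝒜₂^q`: `s₁` is `QIsometryAlgebra.s q 0` and `s₂` is
`QIsometryAlgebra.s q 1`. -/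
abbrev QIsometryAlgebra.s (q : ℂ) (j : Fin 2) : QIsometryAlgebra q := IsometryAlgebra.gen _ j

/-- The generating unitaries of `𝒜_q`. -/
abbrev RotationAlgebra.u (q : ℂ) (j : Fin 2) : RotationAlgebra q := IsometryAlgebra.gen _ j

/-- The defining relation of `𝒜₂^q`. -/
theorem QIsometryAlgebra.s_comm (q : ℂ) :
    QIsometryAlgebra.s q 1 * QIsometryAlgebra.s q 0
      = q • (QIsometryAlgebra.s q 0 * QIsometryAlgebra.s q 1) := by
  have h := IsometryAlgebra.mk_eq_zero_of_rel (R := {qRel q}) (Set.mem_singleton (qRel q))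
  rw [qRel, map_sub, map_smul, map_mul, map_mul, sub_eq_zero] at h
  exact h

/-- The defining relation of `𝒜_q`. -/
theorem RotationAlgebra.u_comm (q : ℂ) :
    RotationAlgebra.u q 1 * RotationAlgebra.u q 0
      = q • (RotationAlgebra.u q 0 * RotationAlgebra.u q 1) := by
  have h := IsometryAlgebra.mk_eq_zero_of_rel (Set.mem_insert (qRel q)
    (Set.range fun j : Fin 2 => StarPoly.gen j * star (StarPoly.gen j) - 1))
  rw [qRel, map_sub, map_smul, map_mul, map_mul, sub_eq_zero] at h
  exact h

/-- The generators of `𝒜_q` are unitary. -/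
theorem RotationAlgebra.u_mem_unitary (q : ℂ) (j : Fin 2) :
    RotationAlgebra.u q j ∈ unitary (RotationAlgebra q) := by
  refine ⟨IsometryAlgebra.star_gen_mul_gen j, ?_⟩
  have h := IsometryAlgebra.mk_eq_zero_of_rel (Set.mem_insert_of_mem (qRel q)
    (Set.mem_range_self (f := fun j : Fin 2 => StarPoly.gen j * star (StarPoly.gen j) - 1) j))
  rw [map_sub, map_mul, map_one, sub_eq_zero, ← IsometryAlgebra.star_mk] at h
  exact h

/-! ### Tracial states -/

/-- Normalized tracial states: positive linear functionals `τ` with `τ 1 = 1` and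
`τ (a b) = τ (b a)`. -/
structure IsTracialState {A : Type*} [CStarAlgebra A] (τ : A →ₗ[ℂ] ℂ) : Prop where
  nonneg : ∀ a, 0 ≤ (τ (star a * a)).re ∧ (τ (star a * a)).im = 0
  map_one : τ 1 = 1
  tracial : ∀ a b, τ (a * b) = τ (b * a)

end

/-!
Write `A` for the algebra of two isometries `s₁, s₂` with `s₂ s₁ = q s₁ s₂` and `A_q` for the
rotation algebra.

*Tracial states exist.* A state `φ` that is invariant under `x ↦ s⋆ x s` for an isometry `s`
satisfies `φ (s x) = φ (s⋆ (s x) s) = φ (x s)`, so a state invariant under both generators is a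
trace. Cesàro averaging over the compressions `x ↦ s⋆ᵏ x sᵏ` for `s₁` and then for `s₂` produces
such a state, because the two compressions commute (`exists_invariant_mean`,
`QIsometryAlgebra.exists_tracialState_of_functional`). If the initial functional annihilates an
ideal, so does the trace; hence every proper ideal is annihilated by a tracial state
(`QIsometryAlgebra.exists_tracialState`).

*The quotient.* Let `t = s₁ s₂` and let `K` be the set of all `k` with `k tⁿ → 0`. As `t` commutes
with the generators up to phases and absorbs their adjoints, `K` is a two-sided ideal; since
`1 - tⁿ tⁿ⋆` lies in the ideal generated by the defect projections `1 - s_j s_j⋆`, `K` is the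
closure of that ideal (`QIsometryAlgebra.coe_defectIdeal`), and the distance to `K` is a
C⋆-seminorm on `A` (`QIsometryAlgebra.infDist_star_mul_self`). Maximality of the norm of `A_q` then identifies `A / K`
with `A_q` isometrically (`QIsometryAlgebra.norm_toRotation`).

*Uniqueness and faithfulness.* A tracial state of `A` kills `K` and descends to a functional on
`A_q` invariant under conjugation by `u₁` and `u₂`. Conjugation multiplies the monomial `u₁ᵐ u₂ⁿ` by
`qᵐ` or `q⁻ⁿ`, so such a functional is determined by its value at `1` when `q` is not a root of
unity (`RotationAlgebra.eq_zero_of_invariant`). If `c ≠ 0` and `φ` is a state with `φ (c⋆ c) ≠ 0`,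
the integral of `φ` over the gauge action of the torus is such a functional, equal to the trace of
`A_q`, and it is positive at `c⋆ c`; so that trace is faithful
(`RotationAlgebra.eq_zero_of_apply_star_mul_self`) and `K` is the null ideal of the trace of `A`. A
proper ideal is annihilated by a tracial state, which is the only one, and is thus contained in `K`.
Everything is nonzero because `A_q` acts on `ℓ²(ℤ)` (`RotationAlgebra.nontrivial`).
-/

open Filter Topology Finset
open scoped ComplexOrder

/-! ### Contractive functionals, invariant means and tracial states -/

section functionals

variable {A : Type*} [CStarAlgebra A]

/-- A contractive functional that takes the value `1` at `1` is positive. -/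
theorem StrongDual.isPositive_of_norm_le_one (φ : StrongDual ℂ A) (hφ : ‖φ‖ ≤ 1) (h1 : φ 1 = 1)
    (a : A) : 0 ≤ (φ (star a * a)).re ∧ (φ (star a * a)).im = 0 := by
  let _ := CStarAlgebra.spectralOrder A
  have _ := CStarAlgebra.spectralOrderedRing A
  set h := star a * a with hh
  have hle : ∀ x, ‖φ x‖ ≤ ‖x‖ := fun x => φ.le_of_opNorm_le_of_le hφ le_rfl |>.trans (by simp)
  have hsa : star h = h := by simp [hh]
  constructor
  -- From `0 ≤ h ≤ ‖h‖` one gets `‖‖h‖ - h‖ ≤ ‖h‖`, so `φ h` lies in the disc of radius `‖h‖`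
  -- around `‖h‖`.
  · have hpos : 0 ≤ h := star_mul_self_nonneg a
    have hup : h ≤ algebraMap ℝ A ‖h‖ := IsSelfAdjoint.le_algebraMap_norm_self hsa
    have hn : ‖algebraMap ℝ A ‖h‖ - h‖ ≤ ‖h‖ := by
      rw [CStarAlgebra.norm_le_iff_le_algebraMap _ (norm_nonneg h) (sub_nonneg.2 hup)]
      exact sub_le_self _ hpos
    have := hle (algebraMap ℝ A ‖h‖ - h)
    have hmap : φ (algebraMap ℝ A ‖h‖) = ‖h‖ := by
      rw [IsScalarTower.algebraMap_apply ℝ ℂ A, Algebra.algebraMap_eq_smul_one, map_smul, h1]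
      simp
    rw [map_sub, hmap] at this
    have h2 := (Complex.re_le_norm _).trans (this.trans hn)
    simp at h2
    exact h2
  -- Comparing `φ (h + i t)` with `‖h + i t‖² ≤ ‖h‖² + t²` for all real `t` forces `φ h` to be real.
  · have key : ∀ t : ℝ, (φ h).re ^ 2 + ((φ h).im + t) ^ 2 ≤ ‖h‖ ^ 2 + t ^ 2 := by
      intro t
      have e : star (h + algebraMap ℂ A (t * Complex.I)) * (h + algebraMap ℂ A (t * Complex.I))
          = h * h + algebraMap ℂ A (t ^ 2) := by
        have hc := Algebra.commutes (t * Complex.I : ℂ) h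
        have hs : star (algebraMap ℂ A (t * Complex.I)) = - algebraMap ℂ A (t * Complex.I) := by
          rw [← algebraMap_star_comm, ← map_neg]; congr 1; simp
        have hsq : algebraMap ℂ A (t * Complex.I) * algebraMap ℂ A (t * Complex.I)
            = - algebraMap ℂ A (t ^ 2) := by
          rw [← map_mul, ← map_neg]; congr 1
          linear_combination (t : ℂ) ^ 2 * Complex.I_mul_I
        rw [star_add, hsa, hs, add_mul, mul_add, neg_mul, mul_add, hsq, hc]
        abel
      have n1 : ‖h + algebraMap ℂ A (t * Complex.I)‖ ^ 2 ≤ ‖h‖ ^ 2 + t ^ 2 := by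
        rw [sq, ← CStarRing.norm_star_mul_self, e]
        refine (norm_add_le _ _).trans (add_le_add ?_ ?_)
        · rw [sq]; exact norm_mul_le _ _
        · rw [Algebra.algebraMap_eq_smul_one, norm_smul]
          refine (mul_le_of_le_one_right (norm_nonneg _) ?_).trans ?_
          · have := CStarRing.norm_star_mul_self (x := (1 : A))
            rw [star_one, one_mul] at this
            nlinarith [norm_nonneg (1 : A)]
          · simp
      refine le_trans ?_ n1
      have n2 := hle (h + algebraMap ℂ A (t * Complex.I))
      rw [map_add, Algebra.algebraMap_eq_smul_one, map_smul, h1] at n2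
      calc _ = ‖φ h + (t * Complex.I : ℂ) • (1 : ℂ)‖ ^ 2 := by
            rw [← Complex.normSq_eq_norm_sq, Complex.normSq_apply]; simp; ring
        _ ≤ _ := by gcongr; rwa [Algebra.algebraMap_eq_smul_one]
    by_contra hne
    have hb := key ((‖h‖ ^ 2 + 1) / (2 * (φ h).im))
    have h4 : (φ h).im * ((‖h‖ ^ 2 + 1) / (2 * (φ h).im)) = (‖h‖ ^ 2 + 1) / 2 := by
      field_simp
    nlinarith [sq_nonneg (φ h).re, sq_nonneg (φ h).im]

/-- Compression `x ↦ v⋆ x v` by an element `v`, as a bounded operator. -/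
noncomputable def conjCLM (v : A) : A →L[ℂ] A :=
  (ContinuousLinearMap.mul ℂ A (star v)).comp ((ContinuousLinearMap.mul ℂ A).flip v)

lemma conjCLM_apply (v x : A) : conjCLM v x = star v * x * v := by
  simp [conjCLM, mul_assoc]

lemma norm_le_one_of_isometry {v : A} (hv : star v * v = 1) : ‖v‖ ≤ 1 := by
  have h := CStarRing.norm_star_mul_self (x := v)
  have h' := CStarRing.norm_star_mul_self (x := (1 : A))
  rw [star_one, one_mul] at h'
  rw [hv] at h
  have h1 : ‖(1 : A)‖ ≤ 1 := by
    by_contra hlt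
    nlinarith [norm_nonneg (1 : A)]
  by_contra hlt
  nlinarith [norm_nonneg (1 : A), norm_nonneg v]

lemma isometry_pow {v : A} (hv : star v * v = 1) (n : ℕ) : star (v ^ n) * v ^ n = 1 := by
  induction n with
  | zero => simp
  | succ n ih =>
    rw [pow_succ, star_mul, mul_assoc, ← mul_assoc (star (v ^ n)), ih, one_mul, hv]

lemma norm_conj_le {v : A} (hv : star v * v = 1) (x : A) : ‖star v * x * v‖ ≤ ‖x * v‖ := by
  rw [mul_assoc]
  refine (norm_mul_le _ _).trans (mul_le_of_le_one_left (norm_nonneg _) ?_)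
  rw [norm_star]; exact norm_le_one_of_isometry hv

lemma norm_mul_isometry_le {v : A} (hv : star v * v = 1) (x : A) : ‖x * v‖ ≤ ‖x‖ :=
  (norm_mul_le _ _).trans (mul_le_of_le_one_right (norm_nonneg _) (norm_le_one_of_isometry hv))

/-- A weak-⋆ cluster point of the Cesàro means of `x ↦ φ (sᵏ⋆ x sᵏ)` is invariant under
compression by the isometry `s`. It keeps every value that is constant along the sequence. -/
theorem exists_invariant_mean (φ : StrongDual ℂ A) (hφ : ‖φ‖ ≤ 1) {s : A} (hs : star s * s = 1) :
    ∃ ψ : StrongDual ℂ A, ‖ψ‖ ≤ 1 ∧ (∀ x, ψ (star s * x * s) = ψ x) ∧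
      ∀ x c, (∀ k : ℕ, φ (star (s ^ k) * x * s ^ k) = c) → ψ x = c := by
  have hle : ∀ x, ‖φ x‖ ≤ ‖x‖ := fun x => φ.le_of_opNorm_le_of_le hφ le_rfl |>.trans (by simp)
  have hbd : ∀ k x, ‖φ (star (s ^ k) * x * s ^ k)‖ ≤ ‖x‖ := fun k x =>
    (hle _).trans ((norm_conj_le (isometry_pow hs k) x).trans
      (norm_mul_isometry_le (isometry_pow hs k) x))
  let F : ℕ → StrongDual ℂ A := fun N =>
    ((N : ℂ) + 1)⁻¹ • ∑ k ∈ range (N + 1), φ.comp (conjCLM (s ^ k))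
  have hF : ∀ N x, F N x = ((N : ℂ) + 1)⁻¹ * ∑ k ∈ range (N + 1), φ (star (s ^ k) * x * s ^ k) := by
    intro N x
    simp [F, conjCLM_apply]
  have hN : ∀ N : ℕ, ‖((N : ℂ) + 1)⁻¹‖ = ((N : ℝ) + 1)⁻¹ := by
    intro N
    rw [norm_inv]; congr 1
    exact_mod_cast Complex.norm_natCast (N + 1)
  have hFn : ∀ N, ‖F N‖ ≤ 1 := by
    intro N
    refine ContinuousLinearMap.opNorm_le_bound _ zero_le_one fun x => ?_
    rw [hF, norm_mul, hN, one_mul, inv_mul_le_iff₀ (by positivity)]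
    refine (norm_sum_le _ _).trans ((sum_le_card_nsmul _ _ _ fun k _ => hbd k x).trans ?_)
    simp
  -- By Banach–Alaoglu the means converge weak-⋆ along a nonprincipal ultrafilter.
  obtain ⟨ψ, hψ, hlim⟩ := (WeakDual.isCompact_closedBall (0 : StrongDual ℂ A) 1).ultrafilter_le_nhds
    ((hyperfilter ℕ).map fun N => StrongDual.toWeakDual (F N)) (by
      rw [le_principal_iff, Ultrafilter.mem_coe, Ultrafilter.mem_map]
      exact Filter.univ_mem' fun N => by simpa using hFn N)
  have ht : ∀ x, Tendsto (fun N => F N x) (hyperfilter ℕ) (𝓝 (ψ x)) := fun x =>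
    ((WeakDual.eval_continuous x).tendsto ψ).comp hlim
  have hat : (hyperfilter ℕ : Filter ℕ) ≤ atTop := Nat.hyperfilter_le_atTop
  refine ⟨WeakDual.toStrongDual ψ, by simpa using hψ, fun x => ?_, fun x c hc => ?_⟩
  · refine tendsto_nhds_unique_of_eventuallyEq (ht (star s * x * s)) ((ht x).add
      (show Tendsto (fun N => F N (star s * x * s) - F N x) (hyperfilter ℕ) (𝓝 0) from ?_)) ?_ |>.trans
      (add_zero _)
    · refine Tendsto.mono_left ?_ hat
      refine squeeze_zero_norm (a := fun N : ℕ => (2 * ‖x‖) * ((N : ℝ) + 1)⁻¹) (fun N => ?_) ?_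
      · rw [hF, hF, ← mul_sub, norm_mul, hN, mul_comm]
        gcongr
        have e : ∀ k, φ (star (s ^ k) * (star s * x * s) * s ^ k)
            = φ (star (s ^ (k + 1)) * x * s ^ (k + 1)) := by
          intro k; rw [pow_succ', star_mul]; simp only [mul_assoc]
        simp only [e]
        rw [← sum_sub_distrib, sum_range_sub (fun k => φ (star (s ^ k) * x * s ^ k))]
        refine (norm_sub_le _ _).trans ?_
        linarith [hbd (N + 1) x, hbd 0 x]
      · rw [← mul_zero (2 * ‖x‖)]
        have := tendsto_one_div_add_atTop_nhds_zero_nat (𝕜 := ℝ)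
        simp only [one_div] at this
        exact this.const_mul _
    · exact Eventually.of_forall fun N => by simp
  · refine tendsto_nhds_unique (ht x) (tendsto_const_nhds.congr fun N => ?_)
    rw [hF, sum_congr rfl fun k _ => hc k]
    have : (N : ℂ) + 1 ≠ 0 := by exact_mod_cast N.succ_ne_zero
    simp; field_simp

/-- Invariance under compression by `s` is the trace property for products with `s` and `s⋆`. -/
theorem map_mul_comm_of_invariant {σ : A →ₗ[ℂ] ℂ} {s : A} (hs : star s * s = 1)
    (h : ∀ x, σ (star s * x * s) = σ x) (x : A) :
    σ (s * x) = σ (x * s) ∧ σ (star s * x) = σ (x * star s) := by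
  constructor
  · rw [← h (s * x), ← mul_assoc, hs, one_mul]
  · rw [← h (x * star s), ← mul_assoc, mul_assoc _ (star s), hs, mul_one]

namespace IsTracialState

variable {τ : A →ₗ[ℂ] ℂ}

/-- A tracial state as a positive linear map, for any order that makes `A` a ⋆-ordered ring. -/
noncomputable def toPositiveLinearMap [PartialOrder A] [StarOrderedRing A]
    (hτ : IsTracialState τ) : A →ₚ[ℂ] ℂ :=
  PositiveLinearMap.mk₀ τ fun x hx => by
    obtain ⟨b, rfl⟩ := CStarAlgebra.nonneg_iff_eq_star_mul_self.1 hx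
    rw [Complex.nonneg_iff]
    exact ⟨(hτ.nonneg b).1, (hτ.nonneg b).2.symm⟩

theorem exists_bound (hτ : IsTracialState τ) : ∃ C : ℝ, ∀ x, ‖τ x‖ ≤ C * ‖x‖ := by
  let _ := CStarAlgebra.spectralOrder A
  have _ := CStarAlgebra.spectralOrderedRing A
  let f : A →ₚ[ℂ] ℂ := hτ.toPositiveLinearMap
  obtain ⟨C, hC⟩ := f.exists_norm_apply_le
  exact ⟨C, hC⟩

/-- This is the Cauchy–Schwarz inequality for `⟪a, b⟫ = τ (a⋆ b)`. -/
theorem map_mul_eq_zero (hτ : IsTracialState τ) (x : A) {p : A} (hp : τ (star p * p) = 0) :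
    τ (x * p) = 0 := by
  let _ := CStarAlgebra.spectralOrder A
  have _ := CStarAlgebra.spectralOrderedRing A
  let f : A →ₚ[ℂ] ℂ := hτ.toPositiveLinearMap
  have h0 : ‖f.toPreGNS p‖ = 0 := by
    rw [PositiveLinearMap.preGNS_norm_def]
    have : f (star p * p) = 0 := hp
    simp [this]
  have h := norm_inner_le_norm (𝕜 := ℂ) (f.toPreGNS (star x)) (f.toPreGNS p)
  rw [h0, mul_zero, PositiveLinearMap.preGNS_inner_def, norm_le_zero_iff] at h
  rw [← star_star x]
  exact h

/-- The projection `p = 1 - s s⋆` has trace zero, so `τ (x p) = 0`; this is the converse of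
`map_mul_comm_of_invariant`. -/
theorem invariant (hτ : IsTracialState τ) {s : A} (hs : star s * s = 1) (x : A) :
    τ (star s * x * s) = τ x := by
  have hp : star (1 - s * star s) * (1 - s * star s) = 1 - s * star s := by
    have : s * star s * (s * star s) = s * star s := by
      rw [mul_assoc, ← mul_assoc (star s), hs, one_mul]
    simp [sub_mul, mul_sub, this]
  have h := hτ.map_mul_eq_zero x (p := 1 - s * star s) (by
    rw [hp, map_sub, hτ.tracial, hs, sub_self])
  rw [mul_sub, map_sub, mul_one, sub_eq_zero, ← mul_assoc, hτ.tracial, ← mul_assoc] at h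
  exact h.symm

end IsTracialState

end functionals

/-! ### Functionals invariant under two isometries -/

namespace IsometryAlgebra

variable {X : Type} {R : Set (StarPoly X)}

/-- A closed property that holds for scalars, generators and their adjoints and is stable under
sums and products holds everywhere. -/
theorem closed_induction {P : IsometryAlgebra R → Prop} (hcl : IsClosed {a | P a})
    (hc : ∀ c : ℂ, P (algebraMap ℂ _ c)) (hg : ∀ x, P (gen R x)) (hs : ∀ x, P (star (gen R x)))
    (hadd : ∀ a b, P a → P b → P (a + b)) (hmul : ∀ a b, P a → P b → P (a * b))
    (a : IsometryAlgebra R) : P a := by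
  refine denseRange_mk.induction_on (p := P) a hcl fun f => ?_
  induction f using StarPoly.poly_induction with
  | hc c => rw [AlgHom.commutes]; exact hc c
  | hl x b =>
    cases b with
    | false => exact hg x
    | true =>
      have := hs x
      rwa [gen, star_mk, StarPoly.gen, StarPoly.star_letter] at this
  | hadd f g hf hg => rw [map_add]; exact hadd _ _ hf hg
  | hmul f g hf hg => rw [map_mul]; exact hmul _ _ hf hg

/-- The elements `a` with `φ (a b) = φ (b a)` for all `b` form a closed subalgebra, which contains
the generators and their adjoints. -/
theorem isTracialState_of_invariant (φ : StrongDual ℂ (IsometryAlgebra R)) (hφ : ‖φ‖ ≤ 1)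
    (h1 : φ 1 = 1) (h : ∀ j x, φ (star (gen R j) * x * gen R j) = φ x) :
    IsTracialState (φ : IsometryAlgebra R →ₗ[ℂ] ℂ) where
  nonneg := φ.isPositive_of_norm_le_one hφ h1
  map_one := h1
  tracial a := by
    have H := fun j => map_mul_comm_of_invariant (σ := (φ : IsometryAlgebra R →ₗ[ℂ] ℂ))
      (star_gen_mul_gen j) (h j)
    simp only [ContinuousLinearMap.coe_coe] at H ⊢
    refine closed_induction (P := fun a => ∀ b, φ (a * b) = φ (b * a)) ?_ ?_ (fun j b => (H j b).1)
      (fun j b => (H j b).2) ?_ ?_ a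
    · simp only [Set.ofPred_forall]
      exact isClosed_iInter fun b => isClosed_eq (by fun_prop) (by fun_prop)
    · intro c b; rw [Algebra.commutes]
    · intro a b ha hb x; rw [add_mul, mul_add, map_add, map_add, ha, hb]
    · intro a b ha hb x; rw [mul_assoc, ha, mul_assoc, hb, mul_assoc]

end IsometryAlgebra

namespace QIsometryAlgebra

variable {q : ℂ}

lemma isometry (j : Fin 2) : star (s q j) * s q j = 1 := IsometryAlgebra.star_gen_mul_gen j

/-- The compressions by the two generators commute, as the phases cancel. -/
lemma star_mul_comm_mul (hq : ‖q‖ = 1) (x : QIsometryAlgebra q) :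
    star (s q 0) * (star (s q 1) * x * s q 1) * s q 0
      = star (s q 1) * (star (s q 0) * x * s q 0) * s q 1 := by
  have h := s_comm q
  have h' := congrArg star h
  simp only [star_mul, star_smul] at h'
  calc _ = (star (s q 0) * star (s q 1)) * x * (s q 1 * s q 0) := by simp only [mul_assoc]
    _ = (star q * q) • ((star (s q 1) * star (s q 0)) * x * (s q 0 * s q 1)) := by
        rw [h, h']; simp only [smul_mul_assoc, mul_smul_comm, smul_smul]
        rw [mul_comm]
    _ = _ := by
        have : star q * q = 1 := by
          rw [Complex.star_def, Complex.conj_mul', hq]; simp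
        rw [this, one_smul]; simp only [mul_assoc]

lemma star_pow_comm_mul (hq : ‖q‖ = 1) (k : ℕ) (x : QIsometryAlgebra q) :
    star (s q 1 ^ k) * (star (s q 0) * x * s q 0) * s q 1 ^ k
      = star (s q 0) * (star (s q 1 ^ k) * x * s q 1 ^ k) * s q 0 := by
  induction k with
  | zero => simp
  | succ k ih =>
    have e : ∀ y, star (s q 1 ^ (k + 1)) * y * s q 1 ^ (k + 1)
        = star (s q 1) * (star (s q 1 ^ k) * y * s q 1 ^ k) * s q 1 := by
      intro y; rw [pow_succ, star_mul]; simp only [mul_assoc]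
    rw [e, ih, e, star_mul_comm_mul hq]

/-- Averaging over the compressions by the powers of `s₁`, and then of `s₂`, turns a contractive
unital functional into a tracial state. An ideal annihilated by the functional is annihilated by the
trace. -/
theorem exists_tracialState_of_functional (hq : ‖q‖ = 1) (φ : StrongDual ℂ (QIsometryAlgebra q))
    (hφ : ‖φ‖ ≤ 1) (h1 : φ 1 = 1) (J : TwoSidedIdeal (QIsometryAlgebra q))
    (hJ : ∀ a ∈ J, φ a = 0) :
    ∃ τ : QIsometryAlgebra q →ₗ[ℂ] ℂ, IsTracialState τ ∧ ∀ a ∈ J, τ a = 0 := by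
  obtain ⟨ψ, hψ, hinv, hval⟩ := exists_invariant_mean φ hφ (isometry 0)
  obtain ⟨ρ, hρ, hinv', hval'⟩ := exists_invariant_mean ψ hψ (isometry 1)
  have hψ1 : ψ 1 = 1 := hval 1 1 fun k => by
    rw [mul_one, isometry_pow (isometry 0), h1]
  have hψJ : ∀ a ∈ J, ψ a = 0 := fun a ha => hval a 0 fun k =>
    hJ _ (J.mul_mem_right _ _ (J.mul_mem_left _ _ ha))
  refine ⟨ρ, IsometryAlgebra.isTracialState_of_invariant ρ hρ ?_ fun j x => ?_, ?_⟩
  · exact hval' 1 1 fun k => by rw [mul_one, isometry_pow (isometry 1), hψ1]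
  · fin_cases j
    · rw [← sub_eq_zero, ← map_sub]
      refine hval' _ 0 fun k => ?_
      rw [mul_sub, sub_mul, map_sub, sub_eq_zero]
      exact (congrArg ψ (star_pow_comm_mul hq k x)).trans (hinv _)
    · exact hinv' x
  · exact fun a ha => hval' a 0 fun k =>
      hψJ _ (J.mul_mem_right _ _ (J.mul_mem_left _ _ ha))

end QIsometryAlgebra

namespace TwoSidedIdeal

variable {A : Type*} [CStarAlgebra A]

/-- A two-sided ideal of a complex algebra as a linear subspace. -/
noncomputable def toSubmodule (J : TwoSidedIdeal A) : Submodule ℂ A := J.asIdeal.restrictScalars ℂ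

lemma mem_toSubmodule {J : TwoSidedIdeal A} {a : A} : a ∈ J.toSubmodule ↔ a ∈ J :=
  mem_asIdeal

lemma norm_mk_toSubmodule (J : TwoSidedIdeal A) (a : A) :
    ‖(Submodule.Quotient.mk a : A ⧸ J.toSubmodule)‖ = Metric.infDist a (J : Set A) :=
  QuotientAddGroup.norm_mk (S := J.toSubmodule.toAddSubgroup) a

lemma nonempty (J : TwoSidedIdeal A) : (J : Set A).Nonempty := ⟨0, J.zero_mem⟩

/-- A proper ideal contains no element of the open unit ball around `1`, as those are invertible.
By Hahn–Banach it is annihilated by a contractive functional that takes the value `1` at `1`. -/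
theorem exists_functional (J : TwoSidedIdeal A) (hJ : J ≠ ⊤) :
    ∃ φ : StrongDual ℂ A, ‖φ‖ ≤ 1 ∧ φ 1 = 1 ∧ ∀ a ∈ J, φ a = 0 := by
  have h1 : ‖(Submodule.Quotient.mk 1 : A ⧸ J.toSubmodule)‖ = 1 := by
    rw [norm_mk_toSubmodule]
    refine le_antisymm ((Metric.infDist_le_dist_of_mem J.zero_mem).trans ?_) ?_
    · rw [dist_zero_right]
      exact norm_le_one_of_isometry (by simp)
    · rw [Metric.le_infDist J.nonempty]
      intro j hj
      by_contra! hlt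
      rw [dist_eq_norm] at hlt
      refine hJ ((one_mem_iff J).1 ?_)
      have h := J.mul_mem_left (↑(Units.oneSub (1 - j) hlt)⁻¹) j hj
      have e : ((Units.oneSub (1 - j) hlt : Aˣ) : A) = j := by simp
      rwa [show (↑(Units.oneSub (1 - j) hlt)⁻¹ : A) * j = 1 from Units.inv_mul_of_eq e] at h
  obtain ⟨g, hg, hg1⟩ := exists_dual_vector ℂ
    (Submodule.Quotient.mk 1 : A ⧸ J.toSubmodule) (by rw [h1]; exact one_ne_zero)
  have hle : ∀ a, ‖g (J.toSubmodule.mkQ a)‖ ≤ 1 * ‖a‖ := fun a => by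
    rw [one_mul]
    exact (g.le_of_opNorm_le hg.le _).trans (by
      rw [one_mul]; exact Submodule.Quotient.norm_mk_le _ a)
  refine ⟨(g.toLinearMap ∘ₗ J.toSubmodule.mkQ).mkContinuous 1 hle,
    LinearMap.mkContinuous_norm_le _ zero_le_one _, ?_, fun a ha => ?_⟩
  · change g (Submodule.Quotient.mk 1) = 1
    rw [hg1, h1]; simp
  · change g (Submodule.Quotient.mk a) = 0
    rw [(Submodule.Quotient.mk_eq_zero _).2 (mem_toSubmodule.2 ha), map_zero]

end TwoSidedIdeal

/-! ### The ideal generated by the defect projections -/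

namespace QIsometryAlgebra

variable {q : ℂ}

variable (q) in
/-- The isometry `t = s₁ s₂`. The range projections of its powers decrease, and `1 - tⁿ tⁿ⋆` is an
approximate unit of the ideal generated by the defect projections of `s₁` and `s₂`. -/
noncomputable def t : QIsometryAlgebra q := s q 0 * s q 1

lemma t_isometry : star (t q) * t q = 1 := by
  rw [t, star_mul, mul_assoc, ← mul_assoc (star (s q 0)), isometry, one_mul, isometry]

lemma t_pow_isometry (n : ℕ) : star (t q ^ n) * t q ^ n = 1 := isometry_pow t_isometry n

lemma s_zero_mul_s_one (hq : ‖q‖ = 1) : s q 0 * s q 1 = q⁻¹ • (s q 1 * s q 0) := by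
  rw [s_comm, smul_smul, inv_mul_cancel₀ (by rintro rfl; simp at hq), one_smul]

/-- `t` commutes with the generators up to a phase. -/
lemma exists_t_mul (hq : ‖q‖ = 1) (j : Fin 2) :
    ∃ c : ℂ, ‖c‖ = 1 ∧ t q * s q j = c • (s q j * t q) := by
  fin_cases j
  · exact ⟨q, hq, by simp only [t, Fin.zero_eta, mul_assoc, s_comm, mul_smul_comm]⟩
  · refine ⟨q⁻¹, by simp [hq], ?_⟩
    simp only [t, Fin.mk_one]
    nth_rw 1 [s_zero_mul_s_one hq]
    rw [smul_mul_assoc, mul_assoc]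

lemma exists_t_pow_mul (hq : ‖q‖ = 1) (j : Fin 2) (n : ℕ) :
    ∃ c : ℂ, ‖c‖ = 1 ∧ t q ^ n * s q j = c • (s q j * t q ^ n) := by
  obtain ⟨c, hc, h⟩ := exists_t_mul hq j
  refine ⟨c ^ n, by simp [hc], ?_⟩
  induction n with
  | zero => simp
  | succ n ih =>
    rw [pow_succ, mul_assoc, h, mul_smul_comm, ← mul_assoc, ih, smul_mul_assoc, smul_smul,
      pow_succ', mul_assoc]

lemma norm_mul_s_mul_t_pow_le (hq : ‖q‖ = 1) (k : QIsometryAlgebra q) (j : Fin 2) (n : ℕ) :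
    ‖k * s q j * t q ^ n‖ ≤ ‖k * t q ^ n‖ := by
  obtain ⟨c, hc, h⟩ := exists_t_pow_mul hq j n
  calc _ = ‖k * (t q ^ n * s q j)‖ := by
        rw [h, mul_smul_comm, norm_smul, hc, one_mul, mul_assoc]
    _ ≤ _ := by rw [← mul_assoc]; exact norm_mul_isometry_le (isometry j) _

/-- `t` absorbs an adjoint generator: `s₁⋆ t = s₂`, and `s₂⋆ t` is a multiple of `s₁`. -/
lemma exists_star_s_mul_t (hq : ‖q‖ = 1) (j : Fin 2) :
    ∃ (i : Fin 2) (c : ℂ),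
      ‖c‖ = 1 ∧ star (s q j) * t q = c • s q i ∧ s q j * (c • s q i) = t q := by
  fin_cases j
  · refine ⟨1, 1, by simp, ?_, ?_⟩
    · simp only [t, Fin.zero_eta]
      rw [← mul_assoc, isometry, one_mul, one_smul]
    · simp [t]
  · refine ⟨0, q⁻¹, by simp [hq], ?_, ?_⟩
    · simp only [t, Fin.mk_one]
      rw [s_zero_mul_s_one hq, mul_smul_comm, ← mul_assoc, isometry, one_mul]
    · simp only [t, Fin.mk_one]
      rw [mul_smul_comm, s_zero_mul_s_one hq]

lemma norm_mul_star_s_mul_t_pow_le (hq : ‖q‖ = 1) (k : QIsometryAlgebra q) (j : Fin 2) (n : ℕ) :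
    ‖k * star (s q j) * t q ^ (n + 1)‖ ≤ ‖k * t q ^ n‖ := by
  obtain ⟨i, c, hc, h, -⟩ := exists_star_s_mul_t hq j
  rw [pow_succ', mul_assoc, ← mul_assoc (star _), h, smul_mul_assoc, mul_smul_comm, norm_smul, hc,
    one_mul, ← mul_assoc]
  exact norm_mul_s_mul_t_pow_le hq k i n

lemma tendsto_of_mem_closure {k : QIsometryAlgebra q}
    (hk : k ∈ closure {k : QIsometryAlgebra q | Tendsto (fun n => ‖k * t q ^ n‖) atTop (𝓝 0)}) :
    Tendsto (fun n => ‖k * t q ^ n‖) atTop (𝓝 0) := by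
  rw [Metric.tendsto_atTop]
  intro ε hε
  obtain ⟨l, hl, hkl⟩ := Metric.mem_closure_iff.1 hk (ε / 2) (half_pos hε)
  obtain ⟨N, hN⟩ := Metric.tendsto_atTop.1 hl (ε / 2) (half_pos hε)
  refine ⟨N, fun n hn => ?_⟩
  have h1 := hN n hn
  rw [dist_zero_right, norm_norm] at h1 ⊢
  rw [dist_eq_norm] at hkl
  calc ‖k * t q ^ n‖ = ‖(k - l) * t q ^ n + l * t q ^ n‖ := by rw [sub_mul, sub_add_cancel]
    _ ≤ ‖k - l‖ + ‖l * t q ^ n‖ :=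
      (norm_add_le _ _).trans (by gcongr; exact norm_mul_isometry_le (t_pow_isometry n) _)
    _ < ε := by linarith

lemma isClosed_setOf_tendsto :
    IsClosed {k : QIsometryAlgebra q | Tendsto (fun n => ‖k * t q ^ n‖) atTop (𝓝 0)} :=
  isClosed_of_closure_subset fun _ => tendsto_of_mem_closure

/-- The left ideal of all `k` with `k tⁿ → 0` is also a right ideal. -/
lemma tendsto_mul (hq : ‖q‖ = 1) (a : QIsometryAlgebra q) :
    ∀ k : QIsometryAlgebra q, Tendsto (fun n => ‖k * t q ^ n‖) atTop (𝓝 0) →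
      Tendsto (fun n => ‖k * a * t q ^ n‖) atTop (𝓝 0) := by
  refine IsometryAlgebra.closed_induction (P := fun a : QIsometryAlgebra q =>
    ∀ k : QIsometryAlgebra q, Tendsto (fun n => ‖k * t q ^ n‖) atTop (𝓝 0) →
      Tendsto (fun n => ‖k * a * t q ^ n‖) atTop (𝓝 0)) ?_ ?_ ?_ ?_ ?_ ?_ a
  · simp only [Set.ofPred_forall]
    refine isClosed_iInter fun k => isClosed_iInter fun _ => ?_
    exact isClosed_setOf_tendsto.preimage (continuous_const_mul k)
  · intro c k hk
    have := hk.const_mul ‖c‖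
    rw [mul_zero] at this
    refine this.congr fun n => ?_
    rw [← Algebra.commutes, ← Algebra.smul_def, smul_mul_assoc, norm_smul]
  · exact fun j k hk => squeeze_zero (fun _ => norm_nonneg _)
      (fun n => norm_mul_s_mul_t_pow_le hq k j n) hk
  · exact fun j k hk => (tendsto_add_atTop_iff_nat 1).1 <| squeeze_zero (fun _ => norm_nonneg _)
      (fun n => norm_mul_star_s_mul_t_pow_le hq k j n) hk
  · intro a b ha hb k hk
    have := (ha k hk).add (hb k hk)
    rw [add_zero] at this
    refine squeeze_zero (fun _ => norm_nonneg _) (fun n => ?_) this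
    rw [mul_add, add_mul]
    exact norm_add_le _ _
  · intro a b ha hb k hk
    simpa only [mul_assoc] using hb _ (ha k hk)

/-- The ideal of all `k` with `k tⁿ → 0`. It is the closed ideal generated by the defect
projections of the generators. -/
noncomputable def defectIdeal (hq : ‖q‖ = 1) : TwoSidedIdeal (QIsometryAlgebra q) :=
  .mk' {k | Tendsto (fun n => ‖k * t q ^ n‖) atTop (𝓝 0)}
    (by simp)
    (fun {x y} hx hy => by
      have := Tendsto.add hx hy
      rw [add_zero] at this
      refine squeeze_zero (fun _ => norm_nonneg _) (fun n => ?_) this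
      rw [add_mul]
      exact norm_add_le _ _)
    (fun {x} hx => by simpa using hx)
    (fun {x y} hy => by
      have := Tendsto.const_mul ‖x‖ hy
      rw [mul_zero] at this
      refine squeeze_zero (fun _ => norm_nonneg _) (fun n => ?_) this
      rw [mul_assoc]
      exact norm_mul_le _ _)
    (fun {x y} hx => tendsto_mul hq y x hx)

lemma mem_defectIdeal {hq : ‖q‖ = 1} {k : QIsometryAlgebra q} :
    k ∈ defectIdeal hq ↔ Tendsto (fun n => ‖k * t q ^ n‖) atTop (𝓝 0) :=
  TwoSidedIdeal.mem_mk' _ _ _ _ _ _ _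

lemma isClosed_defectIdeal (hq : ‖q‖ = 1) :
    IsClosed (defectIdeal hq : Set (QIsometryAlgebra q)) := by
  have : (defectIdeal hq : Set (QIsometryAlgebra q))
      = {k : QIsometryAlgebra q | Tendsto (fun n => ‖k * t q ^ n‖) atTop (𝓝 0)} :=
    TwoSidedIdeal.coe_mk' _ _ _ _ _ _
  rw [this]
  exact isClosed_setOf_tendsto

lemma defect_mem_defectIdeal (hq : ‖q‖ = 1) (j : Fin 2) :
    1 - s q j * star (s q j) ∈ defectIdeal hq := by
  obtain ⟨i, c, hc, h, h'⟩ := exists_star_s_mul_t hq j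
  rw [mem_defectIdeal, ← tendsto_add_atTop_iff_nat 1]
  refine tendsto_const_nhds.congr fun n => ?_
  rw [pow_succ', ← mul_assoc, sub_mul, mul_assoc (s q j), h, h', one_mul, sub_self, zero_mul,
    norm_zero]

/-- The algebraic two-sided ideal generated by the defect projections of the generators. -/
noncomputable abbrev defectSpan (q : ℂ) : TwoSidedIdeal (QIsometryAlgebra q) :=
  TwoSidedIdeal.span (Set.range fun j => 1 - s q j * star (s q j))

lemma one_sub_t_pow_mem_defectSpan (n : ℕ) : 1 - t q ^ n * star (t q ^ n) ∈ defectSpan q := by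
  have hj : ∀ j, 1 - s q j * star (s q j) ∈ defectSpan q := fun j =>
    TwoSidedIdeal.subset_span (Set.mem_range_self j)
  have ht : 1 - t q * star (t q) ∈ defectSpan q := by
    have := (defectSpan q).add_mem (hj 0)
      ((defectSpan q).mul_mem_right _ (star (s q 0)) ((defectSpan q).mul_mem_left (s q 0) _ (hj 1)))
    convert this using 1
    rw [t, star_mul]
    noncomm_ring
  induction n with
  | zero => simp
  | succ n ih =>
    have := (defectSpan q).add_mem ih ((defectSpan q).mul_mem_right _ (star (t q ^ n))
      ((defectSpan q).mul_mem_left (t q ^ n) _ ht))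
    convert this using 1
    rw [pow_succ, star_mul]
    noncomm_ring

theorem coe_defectIdeal (hq : ‖q‖ = 1) :
    (defectIdeal hq : Set (QIsometryAlgebra q)) = closure (defectSpan q) := by
  refine subset_antisymm (fun k hk => ?_) (closure_minimal ?_ (isClosed_defectIdeal hq))
  · refine mem_closure_of_tendsto (f := fun n => k * (1 - t q ^ n * star (t q ^ n))) (b := atTop) ?_
      (Eventually.of_forall fun n =>
        (defectSpan q).mul_mem_left _ _ (one_sub_t_pow_mem_defectSpan n))
    rw [tendsto_iff_norm_sub_tendsto_zero]
    refine squeeze_zero (fun _ => norm_nonneg _) (fun n => ?_) (mem_defectIdeal.1 hk)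
    have : k * (1 - t q ^ n * star (t q ^ n)) - k = - (k * t q ^ n * star (t q ^ n)) := by
      noncomm_ring
    rw [this, norm_neg]
    refine (norm_mul_le _ _).trans (mul_le_of_le_one_right (norm_nonneg _) ?_)
    rw [norm_star]
    exact norm_le_one_of_isometry (t_pow_isometry n)
  · have : defectSpan q ≤ defectIdeal hq :=
      TwoSidedIdeal.span_le.2 (by rintro _ ⟨j, rfl⟩; exact defect_mem_defectIdeal hq j)
    exact this

lemma infDist_defectIdeal_le (hq : ‖q‖ = 1) (a : QIsometryAlgebra q) (n : ℕ) :
    Metric.infDist a (defectIdeal hq : Set (QIsometryAlgebra q)) ≤ ‖a * t q ^ n‖ := by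
  have hm : a * (1 - t q ^ n * star (t q ^ n)) ∈ (defectIdeal hq : Set (QIsometryAlgebra q)) := by
    rw [coe_defectIdeal]
    exact subset_closure ((defectSpan q).mul_mem_left _ _ (one_sub_t_pow_mem_defectSpan n))
  refine (Metric.infDist_le_dist_of_mem hm).trans ?_
  have : a - a * (1 - t q ^ n * star (t q ^ n)) = a * t q ^ n * star (t q ^ n) := by
    noncomm_ring
  rw [dist_eq_norm, this]
  refine (norm_mul_le _ _).trans (mul_le_of_le_one_right (norm_nonneg _) ?_)
  rw [norm_star]
  exact norm_le_one_of_isometry (t_pow_isometry n)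

end QIsometryAlgebra

/-! ### The quotient by the defect ideal -/

lemma StarPoly.eval_qRel {B : Type*} [Ring B] [StarRing B] [Algebra ℂ B] (v : Fin 2 → B) (q : ℂ) :
    StarPoly.eval v (qRel q) = v 1 * v 0 - q • (v 0 * v 1) := by
  rw [qRel, map_sub, map_smul, map_mul, map_mul, StarPoly.eval_gen, StarPoly.eval_gen]

namespace IsometryAlgebra

variable {X : Type} {R : Set (StarPoly X)}

lemma starAlgHom_mk {B : Type*} [CStarAlgebra B] (φ : IsometryAlgebra R →⋆ₐ[ℂ] B)
    (f : StarPoly X) : φ (mk R f) = StarPoly.eval (fun x => φ (gen R x)) f := by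
  induction f using StarPoly.poly_induction with
  | hc c => rw [AlgHom.commutes, AlgHom.commutes]; exact AlgHomClass.commutes φ c
  | hl x b =>
    cases b with
    | false => simp [StarPoly.eval_letter]; rfl
    | true =>
      rw [StarPoly.eval_letter, if_pos rfl, ← map_star, gen, star_mk, StarPoly.gen,
        StarPoly.star_letter]
      rfl
  | hadd f g hf hg => rw [map_add, map_add, map_add, hf, hg]
  | hmul f g hf hg => rw [map_mul, map_mul, map_mul, hf, hg]

lemma mk_eq_eval (f : StarPoly X) : mk R f = StarPoly.eval (gen R) f :=
  starAlgHom_mk (StarAlgHom.id ℂ (IsometryAlgebra R)) f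

end IsometryAlgebra

namespace QIsometryAlgebra

variable {q : ℂ}

lemma star_mem_defectIdeal {hq : ‖q‖ = 1} {k : QIsometryAlgebra q} (hk : k ∈ defectIdeal hq) :
    star k ∈ defectIdeal hq := by
  have h := mem_defectIdeal.1 ((defectIdeal hq).mul_mem_right k (star k) hk)
  have h2 := (Real.continuous_sqrt.tendsto _).comp h
  rw [Real.sqrt_zero] at h2
  refine mem_defectIdeal.2 (squeeze_zero (fun _ => norm_nonneg _) (fun n => ?_) h2)
  refine Real.le_sqrt_of_sq_le ?_
  rw [sq, ← CStarRing.norm_star_mul_self, star_mul, star_star]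
  have := norm_conj_le (t_pow_isometry (q := q) n) (k * star k)
  simpa only [mul_assoc] using this

lemma infDist_star_le (hq : ‖q‖ = 1) (a : QIsometryAlgebra q) :
    Metric.infDist (star a) (defectIdeal hq : Set (QIsometryAlgebra q))
      ≤ Metric.infDist a (defectIdeal hq : Set (QIsometryAlgebra q)) := by
  refine (Metric.le_infDist (defectIdeal hq).nonempty).2 fun {k} hk => ?_
  refine (Metric.infDist_le_dist_of_mem (star_mem_defectIdeal hk)).trans ?_
  rw [dist_eq_norm, dist_eq_norm, ← star_sub, norm_star]

lemma infDist_mul_le (hq : ‖q‖ = 1) (a b : QIsometryAlgebra q) :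
    Metric.infDist (a * b) (defectIdeal hq : Set (QIsometryAlgebra q))
      ≤ Metric.infDist a (defectIdeal hq : Set (QIsometryAlgebra q))
        * Metric.infDist b (defectIdeal hq : Set (QIsometryAlgebra q)) := by
  set K := defectIdeal hq
  have key : ∀ ε > 0, Metric.infDist (a * b) (K : Set (QIsometryAlgebra q))
      ≤ (Metric.infDist a (K : Set (QIsometryAlgebra q)) + ε)
        * (Metric.infDist b (K : Set (QIsometryAlgebra q)) + ε) := by
    intro ε hε
    obtain ⟨k, hk, hak⟩ := (Metric.infDist_lt_iff K.nonempty).1 (lt_add_of_pos_right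
      (Metric.infDist a (K : Set (QIsometryAlgebra q))) hε)
    obtain ⟨l, hl, hbl⟩ := (Metric.infDist_lt_iff K.nonempty).1 (lt_add_of_pos_right
      (Metric.infDist b (K : Set (QIsometryAlgebra q))) hε)
    have hm : a * l + k * (b - l) ∈ (K : Set (QIsometryAlgebra q)) :=
      K.add_mem (K.mul_mem_left _ _ hl) (K.mul_mem_right _ _ hk)
    refine (Metric.infDist_le_dist_of_mem hm).trans ?_
    have : a * b - (a * l + k * (b - l)) = (a - k) * (b - l) := by noncomm_ring
    rw [dist_eq_norm, this]
    rw [dist_eq_norm] at hak hbl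
    exact (norm_mul_le _ _).trans (mul_le_mul hak.le hbl.le (norm_nonneg _)
      ((norm_nonneg _).trans hak.le))
  have hlim : Tendsto (fun ε : ℝ => (Metric.infDist a (K : Set (QIsometryAlgebra q)) + ε)
        * (Metric.infDist b (K : Set (QIsometryAlgebra q)) + ε)) (𝓝[>] 0)
      (𝓝 ((Metric.infDist a (K : Set (QIsometryAlgebra q)) + 0)
        * (Metric.infDist b (K : Set (QIsometryAlgebra q)) + 0))) :=
    (Continuous.tendsto (by fun_prop) _).mono_left nhdsWithin_le_nhds
  simp only [add_zero] at hlim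
  exact ge_of_tendsto hlim (eventually_mem_nhdsWithin.mono key)

/-- The distance to the defect ideal satisfies the C⋆-identity. For `k` in the ideal,
`‖a tⁿ‖² = ‖tⁿ⋆ a⋆ a tⁿ‖ ≤ ‖a⋆ a - k‖ + ‖k tⁿ‖`, and the left-hand side is at least the squared
distance of `a`. -/
lemma infDist_star_mul_self (hq : ‖q‖ = 1) (a : QIsometryAlgebra q) :
    Metric.infDist (star a * a) (defectIdeal hq : Set (QIsometryAlgebra q))
      = Metric.infDist a (defectIdeal hq : Set (QIsometryAlgebra q))
        * Metric.infDist a (defectIdeal hq : Set (QIsometryAlgebra q)) := by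
  refine le_antisymm ((infDist_mul_le hq _ _).trans
    (mul_le_mul_of_nonneg_right (infDist_star_le hq a) Metric.infDist_nonneg)) ?_
  refine (Metric.le_infDist (defectIdeal hq).nonempty).2 fun {k} hk => ?_
  have hlim := (mem_defectIdeal.1 hk).const_add ‖star a * a - k‖
  rw [add_zero] at hlim
  rw [dist_eq_norm]
  refine ge_of_tendsto' hlim fun n => ?_
  have h1 := infDist_defectIdeal_le hq a n
  have hv := t_pow_isometry (q := q) n
  calc _ ≤ ‖a * t q ^ n‖ * ‖a * t q ^ n‖ :=
        mul_le_mul h1 h1 Metric.infDist_nonneg (norm_nonneg _)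
    _ = ‖star (t q ^ n) * (star a * a) * t q ^ n‖ := by
        rw [← CStarRing.norm_star_mul_self, star_mul]; simp only [mul_assoc]
    _ ≤ ‖(star a * a) * t q ^ n‖ := norm_conj_le hv _
    _ = ‖(star a * a - k) * t q ^ n + k * t q ^ n‖ := by rw [sub_mul, sub_add_cancel]
    _ ≤ _ := (norm_add_le _ _).trans (by gcongr; exact norm_mul_isometry_le hv _)

/-- The distance to the defect ideal, as a seminorm on ⋆-polynomials. -/
noncomputable def quotientSeminorm (hq : ‖q‖ = 1) : Seminorm ℂ (StarPoly (Fin 2)) :=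
  (normSeminorm ℂ (QIsometryAlgebra q ⧸ (defectIdeal hq).toSubmodule)).comp
    ((defectIdeal hq).toSubmodule.mkQ ∘ₗ (IsometryAlgebra.mk {qRel q}).toLinearMap)

lemma quotientSeminorm_apply (hq : ‖q‖ = 1) (f : StarPoly (Fin 2)) :
    quotientSeminorm hq f
      = Metric.infDist (IsometryAlgebra.mk {qRel q} f) (defectIdeal hq : Set (QIsometryAlgebra q)) :=
  (defectIdeal hq).norm_mk_toSubmodule _

lemma isAdmissible_quotientSeminorm (hq : ‖q‖ = 1) :
    IsAdmissible (insert (qRel q)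
      (Set.range fun j : Fin 2 => StarPoly.gen j * star (StarPoly.gen j) - 1))
      (quotientSeminorm hq) where
  mul_le f g := by
    simp only [quotientSeminorm_apply, map_mul]; exact infDist_mul_le hq _ _
  star_mul_self f := by
    simp only [quotientSeminorm_apply, map_mul, ← IsometryAlgebra.star_mk]
    exact infDist_star_mul_self hq _
  isometry j := by
    rw [quotientSeminorm_apply, map_sub, map_mul, map_one, ← IsometryAlgebra.star_mk]
    change Metric.infDist (star (s q j) * s q j - 1) _ = 0
    rw [isometry, sub_self]
    exact Metric.infDist_zero_of_mem (defectIdeal hq).zero_mem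
  rel := by
    rintro _ (rfl | ⟨j, rfl⟩)
    · rw [quotientSeminorm_apply, IsometryAlgebra.mk_eq_zero_of_rel (Set.mem_singleton _)]
      exact Metric.infDist_zero_of_mem (defectIdeal hq).zero_mem
    · rw [quotientSeminorm_apply, map_sub, map_mul, map_one, ← IsometryAlgebra.star_mk]
      refine Metric.infDist_zero_of_mem ?_
      have := (defectIdeal hq).neg_mem (defect_mem_defectIdeal hq j)
      rwa [neg_sub] at this

lemma exists_toRotation (q : ℂ) : ∃ φ : QIsometryAlgebra q →⋆ₐ[ℂ] RotationAlgebra q,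
    ∀ j, φ (s q j) = RotationAlgebra.u q j := by
  refine (IsometryAlgebra.existsUnique_starAlgHom (R := {qRel q}) (RotationAlgebra.u q)
    IsometryAlgebra.star_gen_mul_gen ?_).exists
  intro r hr
  rw [Set.mem_singleton_iff.1 hr, StarPoly.eval_qRel, RotationAlgebra.u_comm, sub_self]

/-- The canonical ⋆-homomorphism onto the rotation algebra. -/
noncomputable def toRotation (q : ℂ) : QIsometryAlgebra q →⋆ₐ[ℂ] RotationAlgebra q :=
  (exists_toRotation q).choose

lemma toRotation_s (j : Fin 2) : toRotation q (s q j) = RotationAlgebra.u q j :=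
  (exists_toRotation q).choose_spec j

lemma toRotation_mk (f : StarPoly (Fin 2)) :
    toRotation q (IsometryAlgebra.mk _ f) = IsometryAlgebra.mk _ f := by
  rw [IsometryAlgebra.starAlgHom_mk, IsometryAlgebra.mk_eq_eval]
  exact congrArg (fun v => StarPoly.eval v f) (funext toRotation_s)

lemma continuous_toRotation : Continuous (toRotation q) :=
  NonUnitalStarAlgHom.instContinuousLinearMapClassComplex.map_continuous _

/-- The canonical map induces an isometry on the quotient by the defect ideal: the distance to the
ideal is one of the seminorms over which the norm of the rotation algebra is the supremum. -/
lemma norm_toRotation (hq : ‖q‖ = 1) (a : QIsometryAlgebra q) :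
    ‖toRotation q a‖ = Metric.infDist a (defectIdeal hq : Set (QIsometryAlgebra q)) := by
  refine le_antisymm ((Metric.le_infDist (defectIdeal hq).nonempty).2 fun {k} hk => ?_) ?_
  · have hle : defectSpan q ≤ TwoSidedIdeal.ker (toRotation q) := TwoSidedIdeal.span_le.2 (by
      rintro _ ⟨j, rfl⟩
      rw [SetLike.mem_coe, TwoSidedIdeal.mem_ker, map_sub, map_mul, map_star, map_one, toRotation_s,
        (RotationAlgebra.u_mem_unitary q j).2, sub_self])
    have hk0 : toRotation q k = 0 := by
      rw [coe_defectIdeal] at hk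
      refine closure_minimal (t := {k | toRotation q k = 0}) (fun x hx => ?_)
        (isClosed_eq continuous_toRotation continuous_const) hk
      exact (TwoSidedIdeal.mem_ker _).1 (hle hx)
    have := NonUnitalStarAlgHom.norm_apply_le (toRotation q) (a - k)
    rwa [map_sub, hk0, sub_zero, ← dist_eq_norm] at this
  · refine IsometryAlgebra.denseRange_mk.induction_on (p := fun a =>
      Metric.infDist a (defectIdeal hq : Set (QIsometryAlgebra q)) ≤ ‖toRotation q a‖) a
      (isClosed_le (Metric.continuous_infDist_pt _) continuous_toRotation.norm) fun f => ?_
    rw [toRotation_mk, IsometryAlgebra.norm_mk, ← quotientSeminorm_apply]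
    exact IsoPre.le_maxNorm (isAdmissible_quotientSeminorm hq) f

lemma toRotation_eq_zero_iff (hq : ‖q‖ = 1) (a : QIsometryAlgebra q) :
    toRotation q a = 0 ↔ a ∈ defectIdeal hq := by
  rw [← norm_eq_zero, norm_toRotation hq, ← (isClosed_defectIdeal hq).mem_iff_infDist_zero
    (defectIdeal hq).nonempty]
  rfl

/-- The range is complete, being isometric to the quotient by a closed ideal, and it is dense. -/
lemma toRotation_surjective (hq : ‖q‖ = 1) : Function.Surjective (toRotation q) := by
  set K := (defectIdeal hq).toSubmodule
  have : IsClosed (K : Set (QIsometryAlgebra q)) := isClosed_defectIdeal hq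
  let ι : QIsometryAlgebra q ⧸ K →ₗ[ℂ] RotationAlgebra q :=
    K.liftQ (toRotation q : QIsometryAlgebra q →ₗ[ℂ] RotationAlgebra q)
      fun a ha => (toRotation_eq_zero_iff hq a).2 (TwoSidedIdeal.mem_toSubmodule.1 ha)
  have hι : Isometry ι := AddMonoidHomClass.isometry_of_norm ι fun x => by
    obtain ⟨a, rfl⟩ := K.mkQ_surjective x
    exact (norm_toRotation hq a).trans ((defectIdeal hq).norm_mk_toSubmodule a).symm
  have hd : DenseRange ι := by
    refine (IsometryAlgebra.denseRange_mk (X := Fin 2)).mono ?_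
    rintro _ ⟨f, rfl⟩
    exact ⟨K.mkQ (IsometryAlgebra.mk _ f), toRotation_mk f⟩
  intro b
  have hb : b ∈ Set.range ι := by
    rw [← hι.isClosedEmbedding.isClosed_range.closure_eq, hd.closure_range]
    trivial
  obtain ⟨x, rfl⟩ := hb
  obtain ⟨a, rfl⟩ := K.mkQ_surjective x
  exact ⟨a, rfl⟩

end QIsometryAlgebra

/-! ### Monomials in the rotation algebra and invariant functionals -/

namespace RotationAlgebra

variable {q : ℂ}

variable (q) in
/-- The generators of the rotation algebra as units, so that integral powers make sense. -/
noncomputable def unit (j : Fin 2) : (RotationAlgebra q)ˣ where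
  val := u q j
  inv := star (u q j)
  val_inv := (u_mem_unitary q j).2
  inv_val := (u_mem_unitary q j).1

/-- The scalar `q` as a unit of the rotation algebra. -/
noncomputable def scalarUnit (hq : q ≠ 0) : (RotationAlgebra q)ˣ :=
  Units.map (algebraMap ℂ (RotationAlgebra q)).toMonoidHom (Units.mk0 q hq)

lemma coe_scalarUnit_zpow (hq : q ≠ 0) (m : ℤ) :
    ((scalarUnit hq ^ m : (RotationAlgebra q)ˣ) : RotationAlgebra q) = algebraMap ℂ _ (q ^ m) := by
  rw [scalarUnit, ← map_zpow, Units.coe_map]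
  simp

lemma commute_scalarUnit (hq : q ≠ 0) (x : (RotationAlgebra q)ˣ) : Commute (scalarUnit hq) x :=
  Units.ext (Algebra.commutes q (x : RotationAlgebra q))

lemma unit_comm (hq : q ≠ 0) : unit q 1 * unit q 0 = scalarUnit hq * (unit q 0 * unit q 1) :=
  Units.ext ((u_comm q).trans (Algebra.smul_def _ _))

lemma conj_one_zero (hq : q ≠ 0) :
    unit q 1 * unit q 0 * (unit q 1)⁻¹ = scalarUnit hq * unit q 0 := by
  rw [unit_comm hq]; group

lemma conj_zero_one (hq : q ≠ 0) :
    unit q 0 * unit q 1 * (unit q 0)⁻¹ = (scalarUnit hq)⁻¹ * unit q 1 := by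
  rw [eq_inv_mul_iff_mul_eq, ← mul_assoc, ← mul_assoc, mul_assoc (scalarUnit hq), ← unit_comm hq]
  group

lemma conj_one_zpow_zero (hq : q ≠ 0) (m : ℤ) :
    unit q 1 * unit q 0 ^ m * (unit q 1)⁻¹ = scalarUnit hq ^ m * unit q 0 ^ m := by
  rw [← conj_zpow, conj_one_zero hq, (commute_scalarUnit hq _).mul_zpow]

lemma conj_zero_zpow_one (hq : q ≠ 0) (n : ℤ) :
    unit q 0 * unit q 1 ^ n * (unit q 0)⁻¹ = scalarUnit hq ^ (-n) * unit q 1 ^ n := by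
  rw [← conj_zpow, conj_zero_one hq, (commute_scalarUnit hq _).inv_left.mul_zpow, inv_zpow']

variable (q) in
/-- The monomial `u₁ᵐ u₂ⁿ`. -/
noncomputable def monomial (m n : ℤ) : RotationAlgebra q :=
  ((unit q 0 ^ m * unit q 1 ^ n : (RotationAlgebra q)ˣ) : RotationAlgebra q)

lemma u_zero_mul_monomial (m n : ℤ) : u q 0 * monomial q m n = monomial q (m + 1) n := by
  have : unit q 0 * (unit q 0 ^ m * unit q 1 ^ n) = unit q 0 ^ (m + 1) * unit q 1 ^ n := by
    rw [← mul_assoc, mul_self_zpow]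
  exact congrArg Units.val this

lemma star_u_zero_mul_monomial (m n : ℤ) :
    star (u q 0) * monomial q m n = monomial q (m - 1) n := by
  have : (unit q 0)⁻¹ * (unit q 0 ^ m * unit q 1 ^ n) = unit q 0 ^ (m - 1) * unit q 1 ^ n := by
    rw [← mul_assoc, sub_eq_neg_add, zpow_add, zpow_neg_one]
  exact congrArg Units.val this

lemma u_one_mul_monomial (hq : q ≠ 0) (m n : ℤ) :
    u q 1 * monomial q m n = q ^ m • monomial q m (n + 1) := by
  have : unit q 1 * (unit q 0 ^ m * unit q 1 ^ n)
      = scalarUnit hq ^ m * (unit q 0 ^ m * unit q 1 ^ (n + 1)) := by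
    rw [← mul_assoc, ← mul_assoc, ← conj_one_zpow_zero hq, add_comm n, zpow_one_add]; group
  rw [Algebra.smul_def, ← coe_scalarUnit_zpow hq]
  exact congrArg Units.val this

lemma star_u_one_mul_monomial (hq : q ≠ 0) (m n : ℤ) :
    star (u q 1) * monomial q m n = (q ^ m)⁻¹ • monomial q m (n - 1) := by
  have h := u_one_mul_monomial hq m (n - 1)
  rw [sub_add_cancel] at h
  rw [eq_inv_smul_iff₀ (zpow_ne_zero m hq), ← mul_smul_comm, ← h, ← mul_assoc,
    (u_mem_unitary q 1).1, one_mul]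

lemma conj_u_one_monomial (hq : q ≠ 0) (m n : ℤ) :
    u q 1 * monomial q m n * star (u q 1) = q ^ m • monomial q m n := by
  have : unit q 1 * (unit q 0 ^ m * unit q 1 ^ n) * (unit q 1)⁻¹
      = scalarUnit hq ^ m * (unit q 0 ^ m * unit q 1 ^ n) := by
    rw [← mul_assoc (scalarUnit hq ^ m), ← conj_one_zpow_zero hq]; group
  rw [Algebra.smul_def, ← coe_scalarUnit_zpow hq]
  exact congrArg Units.val this

lemma conj_u_zero_monomial (hq : q ≠ 0) (m n : ℤ) :
    u q 0 * monomial q m n * star (u q 0) = q ^ (-n) • monomial q m n := by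
  have : unit q 0 * (unit q 0 ^ m * unit q 1 ^ n) * (unit q 0)⁻¹
      = scalarUnit hq ^ (-n) * (unit q 0 ^ m * unit q 1 ^ n) := by
    rw [← mul_assoc (scalarUnit hq ^ (-n)), ((commute_scalarUnit hq _).zpow_zpow (-n) m).eq,
      mul_assoc (unit q 0 ^ m), ← conj_zero_zpow_one hq]
    group
  rw [Algebra.smul_def, ← coe_scalarUnit_zpow hq]
  exact congrArg Units.val this

variable (q) in
/-- The closed linear span of the monomials. -/
noncomputable def monomialSpan : Submodule ℂ (RotationAlgebra q) :=
  (Submodule.span ℂ (Set.range fun p : ℤ × ℤ => monomial q p.1 p.2)).topologicalClosure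

lemma monomial_mem (m n : ℤ) : monomial q m n ∈ monomialSpan q :=
  subset_closure (Submodule.subset_span ⟨(m, n), rfl⟩)

lemma mul_mem_monomialSpan {a : RotationAlgebra q}
    (h : ∀ m n, a * monomial q m n ∈ monomialSpan q) {w : RotationAlgebra q}
    (hw : w ∈ monomialSpan q) : a * w ∈ monomialSpan q := by
  let L : RotationAlgebra q →L[ℂ] RotationAlgebra q := ContinuousLinearMap.mul ℂ _ a
  have hle : monomialSpan q ≤ (monomialSpan q).comap (L : RotationAlgebra q →ₗ[ℂ] _) := by
    refine Submodule.topologicalClosure_minimal _ (Submodule.span_le.2 ?_)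
      ((Submodule.isClosed_topologicalClosure _).preimage L.continuous)
    rintro _ ⟨p, rfl⟩
    exact h p.1 p.2
  exact hle hw

lemma monomialSpan_eq_top (hq : q ≠ 0) : monomialSpan q = ⊤ := by
  have key : ∀ a : RotationAlgebra q, ∀ w ∈ monomialSpan q, a * w ∈ monomialSpan q := by
    intro a
    refine IsometryAlgebra.closed_induction (P := fun a : RotationAlgebra q =>
      ∀ w ∈ monomialSpan q, a * w ∈ monomialSpan q) ?_ ?_ ?_ ?_ ?_ ?_ a
    · simp only [Set.ofPred_forall]
      refine isClosed_iInter fun w => isClosed_iInter fun _ => ?_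
      exact (Submodule.isClosed_topologicalClosure _).preimage (continuous_mul_const w)
    · intro c w hw
      rw [← Algebra.smul_def]
      exact Submodule.smul_mem _ _ hw
    · intro j w hw
      refine mul_mem_monomialSpan (fun m n => ?_) hw
      fin_cases j
      · exact (u_zero_mul_monomial m n) ▸ monomial_mem _ _
      · exact (u_one_mul_monomial hq m n) ▸ Submodule.smul_mem _ _ (monomial_mem _ _)
    · intro j w hw
      refine mul_mem_monomialSpan (fun m n => ?_) hw
      fin_cases j
      · exact (star_u_zero_mul_monomial m n) ▸ monomial_mem _ _
      · exact (star_u_one_mul_monomial hq m n) ▸ Submodule.smul_mem _ _ (monomial_mem _ _)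
    · intro a b ha hb w hw
      rw [add_mul]
      exact Submodule.add_mem _ (ha w hw) (hb w hw)
    · intro a b ha hb w hw
      rw [mul_assoc]
      exact ha _ (hb w hw)
  refine eq_top_iff.2 fun a _ => ?_
  have h1 : (1 : RotationAlgebra q) ∈ monomialSpan q := by
    have := monomial_mem (q := q) 0 0
    simpa [monomial] using this
  simpa using key a 1 h1

/-- For `q` not a root of unity, a bounded functional invariant under conjugation by the generators
vanishes on every monomial other than `1`, so it is determined by its value at `1`. -/
theorem eq_zero_of_invariant (hq : q ≠ 0) (hroot : ∀ m : ℤ, q ^ m = 1 → m = 0)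
    (ρ : StrongDual ℂ (RotationAlgebra q)) (hinv : ∀ j x, ρ (u q j * x * star (u q j)) = ρ x)
    (h1 : ρ 1 = 0) : ρ = 0 := by
  have hmon : ∀ m n, ρ (monomial q m n) = 0 := by
    intro m n
    by_cases hm : m = 0
    · by_cases hn : n = 0
      · subst hm hn
        simpa [monomial] using h1
      · have h := hinv 0 (monomial q m n)
        rw [conj_u_zero_monomial hq, map_smul, smul_eq_mul] at h
        by_contra hne
        have := hroot (-n) (mul_right_cancel₀ hne (h.trans (one_mul _).symm))
        omega
    · have h := hinv 1 (monomial q m n)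
      rw [conj_u_one_monomial hq, map_smul, smul_eq_mul] at h
      by_contra hne
      exact hm (hroot m (mul_right_cancel₀ hne (h.trans (one_mul _).symm)))
  have hle : monomialSpan q ≤ LinearMap.ker (ρ : RotationAlgebra q →ₗ[ℂ] ℂ) := by
    refine Submodule.topologicalClosure_minimal _ (Submodule.span_le.2 ?_)
      (isClosed_eq ρ.continuous continuous_const)
    rintro _ ⟨p, rfl⟩
    exact hmon p.1 p.2
  rw [monomialSpan_eq_top hq] at hle
  ext x
  exact hle (Submodule.mem_top (x := x))

end RotationAlgebra

namespace RotationAlgebra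

variable {q : ℂ}

/-! ### The gauge action of the torus -/

/-- The universal property of the rotation algebra. -/
lemma exists_rotationHom {B : Type*} [CStarAlgebra B] (v : Fin 2 → B)
    (hv : ∀ j, star (v j) * v j = 1) (hv' : ∀ j, v j * star (v j) = 1)
    (hcomm : v 1 * v 0 = q • (v 0 * v 1)) :
    ∃ φ : RotationAlgebra q →⋆ₐ[ℂ] B, ∀ j, φ (u q j) = v j := by
  refine (IsometryAlgebra.existsUnique_starAlgHom v hv ?_).exists
  intro r hr
  rcases hr with hr | ⟨j, rfl⟩
  · rw [hr, StarPoly.eval_qRel, hcomm, sub_self]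
  · rw [map_sub, map_mul, StarPoly.eval_star, StarPoly.eval_gen, hv', map_one, sub_self]

lemma exists_gauge (z : Fin 2 → Circle) : ∃ φ : RotationAlgebra q →⋆ₐ[ℂ] RotationAlgebra q,
    ∀ j, φ (u q j) = (z j : ℂ) • u q j := by
  have hz : ∀ j, (z j : ℂ) * star (z j : ℂ) = 1 := fun j => by
    rw [Complex.star_def, Complex.mul_conj, Circle.normSq_coe, Complex.ofReal_one]
  refine exists_rotationHom _ (fun j => ?_) (fun j => ?_) ?_
  · rw [star_smul, smul_mul_smul_comm, mul_comm, hz, (u_mem_unitary q j).1, one_smul]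
  · rw [star_smul, smul_mul_smul_comm, hz, (u_mem_unitary q j).2, one_smul]
  · rw [smul_mul_smul_comm, smul_mul_smul_comm, u_comm, smul_comm, mul_comm]

variable (q) in
/-- The gauge action of the torus: `γ_z (u_j) = z_j u_j`. -/
noncomputable def gauge (z : Fin 2 → Circle) : RotationAlgebra q →⋆ₐ[ℂ] RotationAlgebra q :=
  (exists_gauge z).choose

lemma gauge_u (z : Fin 2 → Circle) (j : Fin 2) : gauge q z (u q j) = (z j : ℂ) • u q j :=
  (exists_gauge z).choose_spec j

lemma norm_gauge_le (z : Fin 2 → Circle) (a : RotationAlgebra q) : ‖gauge q z a‖ ≤ ‖a‖ :=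
  NonUnitalStarAlgHom.norm_apply_le _ a

lemma continuous_gauge_apply (a : RotationAlgebra q) : Continuous fun z => gauge q z a := by
  refine IsometryAlgebra.closed_induction (P := fun a : RotationAlgebra q =>
    Continuous fun z => gauge q z a) ?_ ?_ ?_ ?_ ?_ ?_ a
  · refine isClosed_of_closure_subset fun a ha => ?_
    refine continuous_of_uniform_approx_of_continuous fun U hU => ?_
    obtain ⟨ε, hε, hεU⟩ := Metric.mem_uniformity_dist.1 hU
    obtain ⟨b, hb, hab⟩ := Metric.mem_closure_iff.1 ha ε hε
    refine ⟨_, hb, fun z => hεU ?_⟩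
    rw [dist_eq_norm, ← map_sub]
    exact (norm_gauge_le z _).trans_lt (by rwa [← dist_eq_norm])
  · intro c
    simp only [AlgHomClass.commutes]
    exact continuous_const
  · intro j
    simp only [gauge_u]
    fun_prop
  · intro j
    simp only [map_star, gauge_u]
    fun_prop
  · intro a b ha hb
    simp only [map_add]
    exact ha.add hb
  · intro a b ha hb
    simp only [map_mul]
    exact ha.mul hb

/-- A ⋆-homomorphism is determined by the generators. -/
lemma starAlgHom_ext {B : Type*} [CStarAlgebra B] {φ ψ : RotationAlgebra q →⋆ₐ[ℂ] B}
    (h : ∀ j, φ (u q j) = ψ (u q j)) : φ = ψ := by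
  ext a
  refine IsometryAlgebra.closed_induction (P := fun a : RotationAlgebra q => φ a = ψ a)
    (isClosed_eq (NonUnitalStarAlgHom.instContinuousLinearMapClassComplex.map_continuous φ)
      (NonUnitalStarAlgHom.instContinuousLinearMapClassComplex.map_continuous ψ)) ?_ h ?_ ?_ ?_ a
  · intro c; rw [AlgHomClass.commutes, AlgHomClass.commutes]
  · intro j; rw [map_star, map_star]; exact congrArg star (h j)
  · intro a b ha hb; rw [map_add, map_add, ha, hb]
  · intro a b ha hb; rw [map_mul, map_mul, ha, hb]

lemma gauge_mul (z w : Fin 2 → Circle) (a : RotationAlgebra q) :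
    gauge q z (gauge q w a) = gauge q (w * z) a := by
  have : (gauge q z).comp (gauge q w) = gauge q (w * z) := starAlgHom_ext fun j => by
    rw [StarAlgHom.comp_apply, gauge_u, map_smul, gauge_u, gauge_u, smul_smul]; simp
  exact congrArg (fun φ => φ a) this

lemma gauge_one (a : RotationAlgebra q) : gauge q 1 a = a := by
  have : gauge q 1 = StarAlgHom.id ℂ _ := starAlgHom_ext fun j => by
    rw [gauge_u]; simp
  exact congrArg (fun φ => φ a) this

/-- Conjugation by a generator belongs to the gauge action. -/
lemma exists_gauge_eq_conj (hq : ‖q‖ = 1) (j : Fin 2) :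
    ∃ w : Fin 2 → Circle, ∀ a, u q j * a * star (u q j) = gauge q w a := by
  let U : unitary (RotationAlgebra q) := ⟨u q j, u_mem_unitary q j⟩
  have h0 : q ≠ 0 := by rintro rfl; simp at hq
  suffices ∃ w : Fin 2 → Circle, ∀ i, u q j * u q i * star (u q j) = (w i : ℂ) • u q i by
    obtain ⟨w, hw⟩ := this
    refine ⟨w, fun a => ?_⟩
    have : (Unitary.conjStarAlgAut ℂ (RotationAlgebra q) U : RotationAlgebra q →⋆ₐ[ℂ] _)
        = gauge q w := starAlgHom_ext fun i => by
      rw [gauge_u, ← hw]; rfl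
    exact congrArg (fun φ => φ a) this
  have hz : q ∈ Submonoid.unitSphere ℂ := by simp [Submonoid.unitSphere, hq]
  obtain ⟨z, rfl⟩ : ∃ z : Circle, (z : ℂ) = q := ⟨⟨q, hz⟩, rfl⟩
  fin_cases j
  · refine ⟨![1, z⁻¹], fun i => ?_⟩
    fin_cases i
    · simp [mul_assoc, (u_mem_unitary _ 0).2]
    · have h : u (z : ℂ) 0 * u z 1 = (z : ℂ)⁻¹ • (u z 1 * u z 0) := by
        rw [u_comm (z : ℂ), smul_smul, inv_mul_cancel₀ h0, one_smul]
      simp [h, mul_assoc, (u_mem_unitary _ 0).2]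
  · refine ⟨![z, 1], fun i => ?_⟩
    fin_cases i
    · simp [u_comm, mul_assoc, (u_mem_unitary _ 1).2]
    · simp [mul_assoc, (u_mem_unitary _ 1).2]

end RotationAlgebra

/-- Hahn–Banach applied to `‖b‖ + b`, which has norm `2 ‖b‖`: a contractive functional that attains
this norm must be `1` at the unit and `‖b‖` at `b`. -/
theorem exists_functional_apply_ne_zero {A : Type*} [CStarAlgebra A] {c : A} (hc : c ≠ 0) :
    ∃ φ : StrongDual ℂ A, ‖φ‖ ≤ 1 ∧ φ 1 = 1 ∧ φ (star c * c) ≠ 0 := by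
  let _ := CStarAlgebra.spectralOrder A
  have _ := CStarAlgebra.spectralOrderedRing A
  have _ : Nontrivial A := nontrivial_of_ne c 0 hc
  set b := star c * c with hb
  have hpos : 0 < ‖b‖ := by
    rw [hb, CStarRing.norm_star_mul_self]
    exact mul_pos (norm_pos_iff.2 hc) (norm_pos_iff.2 hc)
  have h1 : ‖(1 : A)‖ ≤ 1 := norm_le_one_of_isometry (by simp)
  have hsp : 2 * ‖b‖ ≤ ‖algebraMap ℝ A ‖b‖ + b‖ := by
    have hm : ‖b‖ + ‖b‖ ∈ spectrum ℝ (algebraMap ℝ A ‖b‖ + b) := by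
      rw [spectrum.add_mem_add_iff]
      exact CStarAlgebra.norm_mem_spectrum_of_nonneg (star_mul_self_nonneg c)
    have := spectrum.norm_le_norm_of_mem hm
    rwa [← two_mul, Real.norm_of_nonneg (by positivity)] at this
  obtain ⟨φ, hφ, hφb⟩ := exists_dual_vector'' ℂ (algebraMap ℝ A ‖b‖ + b)
  have hle : ∀ x, ‖φ x‖ ≤ ‖x‖ := fun x => (φ.le_of_opNorm_le hφ x).trans (by simp)
  have hmap : φ (algebraMap ℝ A ‖b‖) = ‖b‖ * φ 1 := by
    rw [IsScalarTower.algebraMap_apply ℝ ℂ A, Algebra.algebraMap_eq_smul_one, map_smul]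
    simp
  have hre := congrArg Complex.re hφb
  rw [map_add, hmap] at hre
  simp only [Complex.add_re, Complex.re_ofReal_mul] at hre
  have hre' : 2 * ‖b‖ ≤ ‖b‖ * (φ 1).re + (φ b).re := by rw [hre]; simpa using hsp
  have hb1 : (φ b).re ≤ ‖b‖ := (Complex.re_le_norm _).trans (hle b)
  have h11 : ‖φ 1‖ ≤ 1 := (hle 1).trans h1
  have h12 : (φ 1).re ≤ 1 := (Complex.re_le_norm _).trans h11
  have h13 : (φ 1).re = 1 := by nlinarith
  refine ⟨φ, hφ, ?_, fun h0 => ?_⟩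
  · have hsq : (φ 1).re * (φ 1).re + (φ 1).im * (φ 1).im ≤ 1 := by
      rw [← Complex.normSq_apply, Complex.normSq_eq_norm_sq]
      exact pow_le_one₀ (norm_nonneg _) h11
    refine Complex.ext h13 ?_
    rw [h13] at hsq
    simp only [Complex.one_im]
    nlinarith
  · rw [h0, h13] at hre'
    simp only [Complex.zero_re] at hre'
    linarith

namespace RotationAlgebra

variable {q : ℂ}

open MeasureTheory

/-- A normalized functional invariant under conjugation by the generators is faithful. For `c ≠ 0`
take a state `φ` with `φ (c⋆ c) ≠ 0`. The integral of `φ ∘ γ_z` over the torus is invariant, hence a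
multiple of `τ`, and its value at `c⋆ c` is the integral of a nonnegative continuous function that
does not vanish at `z = 1`. -/
theorem eq_zero_of_apply_star_mul_self (hq : ‖q‖ = 1) (hroot : ∀ m : ℤ, q ^ m = 1 → m = 0)
    (τ : StrongDual ℂ (RotationAlgebra q)) (hinv : ∀ j x, τ (u q j * x * star (u q j)) = τ x)
    (h1 : τ 1 = 1) {c : RotationAlgebra q} (hc : τ (star c * c) = 0) : c = 0 := by
  by_contra hne
  obtain ⟨φ, hφ, hφ1, hφc⟩ := exists_functional_apply_ne_zero hne
  have hle : ∀ x, ‖φ x‖ ≤ ‖x‖ := fun x => (φ.le_of_opNorm_le hφ x).trans (by simp)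
  have hq0 : q ≠ 0 := by rintro rfl; simp at hq
  let _ : MeasurableSpace (Fin 2 → Circle) := borel _
  have _ : BorelSpace (Fin 2 → Circle) := ⟨rfl⟩
  let μ : Measure (Fin 2 → Circle) := Measure.haar
  have hcont : ∀ x, Continuous fun z => φ (gauge q z x) := fun x =>
    φ.continuous.comp (continuous_gauge_apply x)
  have hint : ∀ x, Integrable (fun z => φ (gauge q z x)) μ := fun x =>
    (hcont x).integrable_of_hasCompactSupport (HasCompactSupport.of_compactSpace _)
  let F : StrongDual ℂ (RotationAlgebra q) :=
    LinearMap.mkContinuous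
      { toFun := fun x => ∫ z, φ (gauge q z x) ∂μ
        map_add' := fun x y => by
          simp only [map_add]; exact integral_add (hint x) (hint y)
        map_smul' := fun a x => by
          simp only [map_smul]; exact integral_smul a _ }
      (μ.real Set.univ) fun x => by
        refine (norm_integral_le_of_norm_le_const (Eventually.of_forall fun z =>
          (hle _).trans (norm_gauge_le z x))).trans ?_
        rw [mul_comm]
  have hF : ∀ x, F x = ∫ z, φ (gauge q z x) ∂μ := fun x => rfl
  have hFinv : ∀ j x, F (u q j * x * star (u q j)) = F x := by
    intro j x
    obtain ⟨w, hw⟩ := exists_gauge_eq_conj hq j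
    simp only [hF, hw, gauge_mul]
    exact integral_mul_left_eq_self (fun z => φ (gauge q z x)) w
  have hFτ : F - F 1 • τ = 0 := eq_zero_of_invariant hq0 hroot _
    (fun j x => by simp [hFinv, hinv]) (by simp [h1])
  have hF0 : ∫ z, φ (gauge q z (star c * c)) ∂μ = 0 := by
    have := congrArg (fun ρ : StrongDual ℂ (RotationAlgebra q) => ρ (star c * c)) hFτ
    rw [← hF]
    simpa [hc] using this
  have hpos : ∀ z, 0 ≤ (φ (gauge q z (star c * c))).re := fun z => by
    rw [map_mul, map_star]
    exact (φ.isPositive_of_norm_le_one hφ hφ1 _).1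
  have hre0 : ∫ z, (φ (gauge q z (star c * c))).re ∂μ = 0 := by
    have := integral_re (hint (star c * c))
    rw [hF0] at this
    simpa using this
  have hz := (integral_eq_zero_iff_of_nonneg hpos (hint _).re).1 hre0
  have heq := (Continuous.ae_eq_iff_eq μ (Complex.continuous_re.comp (hcont (star c * c)))
    continuous_const).1 hz
  have h0 := congrFun heq 1
  simp only [Function.comp, gauge_one] at h0
  exact hφc (Complex.ext h0 (φ.isPositive_of_norm_le_one hφ hφ1 c).2)

end RotationAlgebra

/-! ### A representation of the rotation algebra -/

/-- Rephasing and permuting a Hilbert basis is implemented by a unitary. -/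
lemma HilbertBasis.exists_unitary {ι E : Type*} [NormedAddCommGroup E] [InnerProductSpace ℂ E]
    [CompleteSpace E] (b : HilbertBasis ι ℂ E) (e : ι ≃ ι) (c : ι → ℂ) (hc : ∀ i, ‖c i‖ = 1) :
    ∃ U : unitary (E →L[ℂ] E), ∀ i, (U : E →L[ℂ] E) (b i) = c i • b (e i) := by
  classical
  have hc0 : ∀ i, c i ≠ 0 := fun i h => by simpa [h] using hc i
  have ho : Orthonormal ℂ fun i => c i • b (e i) := by
    have := b.orthonormal.comp e e.injective
    refine ⟨fun i => by rw [norm_smul, hc, one_mul]; exact this.1 i, fun i j hij => ?_⟩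
    beta_reduce
    rw [inner_smul_left, inner_smul_right, show inner ℂ (b (e i)) (b (e j)) = 0 from this.2 hij]
    simp
  have hd : ⊤ ≤ (Submodule.span ℂ (Set.range fun i => c i • b (e i))).topologicalClosure := by
    rw [← b.dense_span]
    refine Submodule.topologicalClosure_mono (Submodule.span_le.2 ?_)
    rintro _ ⟨i, rfl⟩
    have := Submodule.smul_mem _ (c (e.symm i))⁻¹
      (Submodule.subset_span (R := ℂ) (Set.mem_range_self (f := fun i => c i • b (e i)) (e.symm i)))
    simpa [smul_smul, inv_mul_cancel₀ (hc0 _)] using this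
  refine ⟨Unitary.linearIsometryEquiv.symm
    (b.repr.trans (HilbertBasis.mk ho hd).repr.symm), fun i => ?_⟩
  change (HilbertBasis.mk ho hd).repr.symm (b.repr (b i)) = _
  rw [b.repr_self, HilbertBasis.repr_symm_single, HilbertBasis.coe_mk]

lemma HilbertBasis.continuousLinearMap_ext {ι E : Type*} [NormedAddCommGroup E]
    [InnerProductSpace ℂ E] (b : HilbertBasis ι ℂ E) {S T : E →L[ℂ] E}
    (h : ∀ i, S (b i) = T (b i)) : S = T := by
  refine ContinuousLinearMap.ext_on (s := Set.range b) ?_ (by rintro _ ⟨i, rfl⟩; exact h i)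
  rw [Submodule.dense_iff_topologicalClosure_eq_top]
  exact b.dense_span

/-- The bilateral shift and the diagonal unitary with entries `qⁿ` on `ℓ²(ℤ)` represent the rotation
algebra, so it is not zero. -/
theorem RotationAlgebra.nontrivial {q : ℂ} (hq : ‖q‖ = 1) : Nontrivial (RotationAlgebra q) := by
  have h0 : q ≠ 0 := by rintro rfl; simp at hq
  let b : HilbertBasis ℤ ℂ (lp (fun _ : ℤ => ℂ) 2) := .ofRepr (.refl ℂ _)
  obtain ⟨S, hS⟩ := b.exists_unitary (Equiv.addRight 1) (fun _ => 1) (by simp)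
  obtain ⟨D, hD⟩ := b.exists_unitary (Equiv.refl ℤ) (fun n => q ^ n) (by simp [hq])
  obtain ⟨φ, -⟩ := exists_rotationHom (q := q)
    (B := lp (fun _ : ℤ => ℂ) 2 →L[ℂ] lp (fun _ : ℤ => ℂ) 2)
    ![S, D] (fun j => by fin_cases j <;> simp) (fun j => by fin_cases j <;> simp) (by
      refine b.continuousLinearMap_ext fun n => ?_
      simp [hS, hD, smul_smul, zpow_add_one₀ h0, mul_comm])
  have : Nontrivial (lp (fun _ : ℤ => ℂ) 2) := nontrivial_of_ne (b 0) 0 (b.orthonormal.ne_zero 0)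
  refine nontrivial_of_ne 1 0 fun h => ?_
  have := congrArg φ h
  rw [map_one, map_zero] at this
  exact one_ne_zero this

/-! ### Descent of tracial states and the largest ideal -/

namespace QIsometryAlgebra

variable {q : ℂ}

/-- Tracial states vanish on the ideal, because `σ k = σ (tⁿ⋆ k tⁿ)` tends to `0`. -/
lemma _root_.IsTracialState.map_eq_zero {σ : QIsometryAlgebra q →ₗ[ℂ] ℂ} (hσ : IsTracialState σ)
    {hq : ‖q‖ = 1} {k : QIsometryAlgebra q} (hk : k ∈ defectIdeal hq) : σ k = 0 := by
  obtain ⟨C, hC⟩ := hσ.exists_bound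
  have hlim := (mem_defectIdeal.1 hk).const_mul |C|
  rw [mul_zero] at hlim
  rw [← norm_le_zero_iff]
  refine ge_of_tendsto' hlim fun n => ?_
  rw [← hσ.invariant (t_pow_isometry n) k]
  refine (hC _).trans (mul_le_mul (le_abs_self C) (norm_conj_le (t_pow_isometry n) k)
    (norm_nonneg _) (abs_nonneg C))

/-- A tracial state factors through the rotation algebra. -/
theorem _root_.IsTracialState.exists_descent {σ : QIsometryAlgebra q →ₗ[ℂ] ℂ}
    (hσ : IsTracialState σ) (hq : ‖q‖ = 1) :
    ∃ σ' : StrongDual ℂ (RotationAlgebra q), (∀ a, σ' (toRotation q a) = σ a) ∧ σ' 1 = 1 ∧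
      ∀ j x, σ' (RotationAlgebra.u q j * x * star (RotationAlgebra.u q j)) = σ' x := by
  obtain ⟨C, hC⟩ := hσ.exists_bound
  have hb : ∀ a, ‖σ a‖ ≤ (|C| + 1) * ‖toRotation q a‖ := fun a => by
    rw [norm_toRotation hq, ← div_le_iff₀' (by positivity),
      Metric.le_infDist (defectIdeal hq).nonempty]
    intro k hk
    rw [div_le_iff₀' (by positivity), dist_eq_norm]
    calc ‖σ a‖ = ‖σ (a - k)‖ := by rw [map_sub, hσ.map_eq_zero hk, sub_zero]
      _ ≤ C * ‖a - k‖ := hC _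
      _ ≤ _ := by gcongr; linarith [le_abs_self C]
  obtain ⟨g, hg⟩ := (toRotation q : QIsometryAlgebra q →ₗ[ℂ] RotationAlgebra q)
    |>.exists_rightInverse_of_surjective (LinearMap.range_eq_top.2 (toRotation_surjective hq))
  have hg' : ∀ x, toRotation q (g x) = x := fun x => congrArg (fun f => f x) hg
  let σ' : StrongDual ℂ (RotationAlgebra q) := (σ ∘ₗ g).mkContinuous (|C| + 1) fun x => by
    have := hb (g x)
    rwa [hg'] at this
  have hσ' : ∀ a, σ' (toRotation q a) = σ a := fun a => by
    have hk : g (toRotation q a) - a ∈ defectIdeal hq := by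
      rw [← toRotation_eq_zero_iff, map_sub, hg', sub_self]
    have := hσ.map_eq_zero hk
    rwa [map_sub, sub_eq_zero] at this
  refine ⟨σ', hσ', ?_, fun j x => ?_⟩
  · rw [← map_one (toRotation q), hσ', hσ.map_one]
  · obtain ⟨a, rfl⟩ := toRotation_surjective hq x
    rw [← toRotation_s, ← map_star, ← map_mul, ← map_mul, hσ', hσ', hσ.tracial, ← mul_assoc,
      isometry, one_mul]

/-- For `q` not a root of unity there is at most one tracial state. -/
theorem _root_.IsTracialState.eq (hq : ‖q‖ = 1) (hroot : ∀ m : ℤ, q ^ m = 1 → m = 0)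
    {σ τ : QIsometryAlgebra q →ₗ[ℂ] ℂ} (hσ : IsTracialState σ) (hτ : IsTracialState τ) :
    σ = τ := by
  have hq0 : q ≠ 0 := by rintro rfl; simp at hq
  obtain ⟨σ', h1, h2, h3⟩ := hσ.exists_descent hq
  obtain ⟨τ', h1', h2', h3'⟩ := hτ.exists_descent hq
  have h := RotationAlgebra.eq_zero_of_invariant hq0 hroot (σ' - τ')
    (fun j x => by simp [h3, h3']) (by simp [h2, h2'])
  ext a
  rw [← h1, ← h1', sub_eq_zero.1 h]

/-- Every proper two-sided ideal is annihilated by a tracial state. -/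
theorem exists_tracialState (hq : ‖q‖ = 1) (J : TwoSidedIdeal (QIsometryAlgebra q)) (hJ : J ≠ ⊤) :
    ∃ τ : QIsometryAlgebra q →ₗ[ℂ] ℂ, IsTracialState τ ∧ ∀ a ∈ J, τ a = 0 := by
  obtain ⟨φ, hφ, h1, hφJ⟩ := J.exists_functional hJ
  exact exists_tracialState_of_functional hq φ hφ h1 J hφJ

/-- The defect ideal is the null space of the tracial state. -/
theorem mem_defectIdeal_iff (hq : ‖q‖ = 1) (hroot : ∀ m : ℤ, q ^ m = 1 → m = 0)
    {τ : QIsometryAlgebra q →ₗ[ℂ] ℂ} (hτ : IsTracialState τ) (a : QIsometryAlgebra q) :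
    a ∈ defectIdeal hq ↔ τ (star a * a) = 0 := by
  refine ⟨fun ha => hτ.map_eq_zero ((defectIdeal hq).mul_mem_left _ _ ha), fun h => ?_⟩
  obtain ⟨τ', h1, h2, h3⟩ := hτ.exists_descent hq
  rw [← toRotation_eq_zero_iff]
  refine RotationAlgebra.eq_zero_of_apply_star_mul_self hq hroot τ' h3 h2 ?_
  rw [← map_star, ← map_mul, h1, h]

lemma defectIdeal_ne_top (hq : ‖q‖ = 1) : defectIdeal hq ≠ ⊤ := by
  have := RotationAlgebra.nontrivial hq
  intro h
  have h1 : (1 : QIsometryAlgebra q) ∈ defectIdeal hq := h ▸ TwoSidedIdeal.mem_top _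
  rw [← toRotation_eq_zero_iff, map_one] at h1
  exact one_ne_zero h1

/-- The isomorphism of the quotient by the defect ideal with the rotation algebra. -/
noncomputable def quotientEquiv (hq : ‖q‖ = 1) :
    (defectIdeal hq).ringCon.Quotient ≃ₐ[ℂ] RotationAlgebra q :=
  AlgEquiv.ofBijective
    ((defectIdeal hq).ringCon.liftₐ (toRotation q : QIsometryAlgebra q →ₐ[ℂ] RotationAlgebra q)
      fun a b h => by
        rw [TwoSidedIdeal.rel_iff, ← toRotation_eq_zero_iff, map_sub, sub_eq_zero] at h
        exact h)
    ⟨by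
      intro x y
      induction x, y using Quotient.inductionOn₂ with | _ a b => ?_
      intro h
      have h : toRotation q a = toRotation q b := h
      refine Quotient.sound ?_
      change (defectIdeal hq).ringCon a b
      rw [TwoSidedIdeal.rel_iff, ← toRotation_eq_zero_iff, map_sub, sub_eq_zero, h],
    fun b => by
      obtain ⟨a, rfl⟩ := toRotation_surjective hq b
      exact ⟨(a : (defectIdeal hq).ringCon.Quotient), rfl⟩⟩

lemma quotientEquiv_coe (hq : ‖q‖ = 1) (a : QIsometryAlgebra q) :
    quotientEquiv hq (a : (defectIdeal hq).ringCon.Quotient) = toRotation q a := rfl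

end QIsometryAlgebra

lemma norm_exp_two_pi_mul_I (θ : ℝ) : ‖Complex.exp (2 * Real.pi * Complex.I * θ)‖ = 1 := by
  rw [show (2 * Real.pi * Complex.I * θ : ℂ) = ((2 * Real.pi * θ : ℝ) : ℂ) * Complex.I by
    push_cast; ring]
  exact Complex.norm_exp_ofReal_mul_I _

lemma Irrational.eq_zero_of_exp_zpow_eq_one {θ : ℝ} (hθ : Irrational θ) (m : ℤ)
    (h : Complex.exp (2 * Real.pi * Complex.I * θ) ^ m = 1) : m = 0 := by
  rw [← Complex.exp_int_mul, Complex.exp_eq_one_iff] at h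
  obtain ⟨n, hn⟩ := h
  by_contra hm
  have h2 : (m * θ : ℂ) = n := by
    have : (2 * Real.pi * Complex.I : ℂ) ≠ 0 := Complex.two_pi_I_ne_zero
    apply mul_right_cancel₀ this
    rw [← hn]; ring
  have h3 : m * θ = n := by exact_mod_cast h2
  exact (hθ.intCast_mul hm).ne_int n h3

theorem mainTheorem7 (θ : ℝ) (hθ : Irrational θ) (q : ℂ)
    (hq : q = Complex.exp (2 * Real.pi * Complex.I * θ)) :
    ∃ τ : QIsometryAlgebra q →ₗ[ℂ] ℂ,
      (IsTracialState τ ∧ ∀ σ : QIsometryAlgebra q →ₗ[ℂ] ℂ, IsTracialState σ → σ = τ) ∧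
      ∃ M : TwoSidedIdeal (QIsometryAlgebra q),
        (∀ a, a ∈ M ↔ τ (star a * a) = 0) ∧
        IsGreatest {J : TwoSidedIdeal (QIsometryAlgebra q) |
          IsClosed (J : Set (QIsometryAlgebra q)) ∧ J ≠ ⊤} M ∧
        (M : Set (QIsometryAlgebra q)) = closure (TwoSidedIdeal.span
          (Set.range fun j => 1 - QIsometryAlgebra.s q j * star (QIsometryAlgebra.s q j)) :
            Set (QIsometryAlgebra q)) ∧
        ∃ ψ : M.ringCon.Quotient ≃ₐ[ℂ] RotationAlgebra q,
          (∀ a : QIsometryAlgebra q, ψ (star a : QIsometryAlgebra q) = star (ψ a)) ∧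
          (∀ a : QIsometryAlgebra q, ‖ψ a‖ = Metric.infDist a (M : Set (QIsometryAlgebra q))) ∧
          ∀ j, ψ (QIsometryAlgebra.s q j : QIsometryAlgebra q) = RotationAlgebra.u q j := by
  have hn : ‖q‖ = 1 := hq ▸ norm_exp_two_pi_mul_I θ
  have hroot : ∀ m : ℤ, q ^ m = 1 → m = 0 := hq ▸ hθ.eq_zero_of_exp_zpow_eq_one
  obtain ⟨τ, hτ, -⟩ := QIsometryAlgebra.exists_tracialState hn _
    (QIsometryAlgebra.defectIdeal_ne_top hn)
  have hmem := QIsometryAlgebra.mem_defectIdeal_iff hn hroot hτ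
  refine ⟨τ, ⟨hτ, fun σ hσ => hσ.eq hn hroot hτ⟩, QIsometryAlgebra.defectIdeal hn, hmem,
    ⟨⟨QIsometryAlgebra.isClosed_defectIdeal hn, QIsometryAlgebra.defectIdeal_ne_top hn⟩,
      fun J hJ a ha => ?_⟩, QIsometryAlgebra.coe_defectIdeal hn, QIsometryAlgebra.quotientEquiv hn,
    fun a => ?_, fun a => ?_, fun j => ?_⟩
  · obtain ⟨σ, hσ, hσJ⟩ := QIsometryAlgebra.exists_tracialState hn J hJ.2
    rw [hmem, hτ.eq hn hroot hσ]
    exact hσJ _ (J.mul_mem_left _ _ ha)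
  · rw [QIsometryAlgebra.quotientEquiv_coe, QIsometryAlgebra.quotientEquiv_coe, map_star]
  · rw [QIsometryAlgebra.quotientEquiv_coe, QIsometryAlgebra.norm_toRotation hn]
  · rw [QIsometryAlgebra.quotientEquiv_coe, QIsometryAlgebra.toRotation_s]
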